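/- **Conventions.** Finitary formulas are generated from countably many variables $v_0,v_1,\dots$ by $\top,\neg,\wedge$ (with $\vee,\to$ as abbreviations) and $\Box$. A *finitary one-step axiom* is a Boolean combination of formulas $\Box\pi$, with $\pi$ a Boolean formula in the variables. A *neighborhood algebra* is a Boolean algebra $B$ with an arbitrary map $\Box:B\to B$. A set $Ax$ of finitary one-step axioms *implies* $\phi$ if every neighborhood algebra validating $Ax$ validates $\phi$; $(\mathrm{Conv})$ is $\Box(v\wedge v')\wedge\Box(v\vee v'')\to\Box v$. For a Boolean algebra $B$ and an assignment $\theta$ of the variables in $B$, let $\hat\theta(\pi)\in B$ be the value of $\pi$. A subset $W\subseteq B$ is an *$Ax$-subset* if for every $\phi\in Ax$ and every $\theta$, $\phi$ is true when each $\Box\pi$ in it is read as "$\hat\theta(\pi)\in W$". *Functors.* - $N_{Ax}B$ is the Boolean algebra freely generated by $\{\Box b\mid b\in B\}$ modulo the congruence generated by the equations $\bar\theta(\phi)=1$ ($\phi\in Ax$, $\theta$ an assignment in $B$), where $\bar\theta(\phi)$ is $\phi$ with each $\Box\pi$ replaced by the generator $\Box\hat\theta(\pi)$; $N_{Ax}h(\Box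 b)=\Box h(b)$. The endofunctor $L_{Ax}$ of complete atomic Boolean algebras (CABAs) and complete homomorphisms is defined in the same way, with free CABAs and complete congruences. - $B_{Ax}X$, for a set $X$, is the set of $Ax$-subsets of the powerset $\wp X$, with $B_{Ax}f(W)=\{a'\mid f^{-1}(a')\in W\}$. - For a Stone space $\mathbb X$ with Boolean algebra of clopens $\mathsf{clp}\,\mathbb X$, $D_{Ax}\mathbb X$ is the set of $Ax$-subsets $W$ of $\mathsf{clp}\,\mathbb X$, with the topology generated by the sets $\{W\mid a\in W\}$ and $\{W\mid \mathbb X\setminus a\notin W\}$ ($a$ clopen), and $D_{Ax}f(W)=\{a'\mid f^{-1}(a')\in W\}$. - $D^\sigma\mathbb X$ is the set of all $W\subseteq\wp X$ such that for all $e\subseteq X$: $e\in W$ iff there are a closed $c$ and an open $d$ with $c\subseteq e\subseteq d$ such that every clopen $a$ with $c\subseteq a\subseteq d$ is in $W$. $D^\sigma_{Ax}\mathbb X$ consists of those $W\in D^\sigma\mathbb X$ for which $W\cap\mathsf{clp}\,\mathbb X$ is an $Ax$-subset of $\mathsf{clp}\,\mathbb X$, with the analogous topology and the analogous action on continuous maps.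 *Extensions.* For a set $W$ of clopens of $\mathbb X$, let $W^\sigma$ be the set of all $e\subseteq X$ such that $c\subseteq e\subseteq d$ for some closed $c$ and open $d$ such that every clopen $a$ with $c\subseteq a\subseteq d$ is in $W$. For $\Box:B\to B$, let $\Box^\sigma$ be the map on the canonical extension $B^\sigma$ of $B$ (the powerset of the set of ultrafilters of $B$) given by $$\Box^\sigma x=\bigvee\Big\{\bigwedge\{\Box b\mid b\in B,\ c\le b\le d\}\ \Big|\ c\text{ closed},\ d\text{ open},\ c\le x\le d\Big\},$$ where closed (open) elements are the meets (joins) of elements of $B$. **Theorem.** Let $Ax$ be a set of finitary one-step axioms that implies $(\mathrm{Conv})$. Suppose that for every Stone space $\mathbb X$ with underlying set $X$ and every $W\in D^\sigma\mathbb X$, if $W\cap\mathsf{clp}\,\mathbb X$ is an $Ax$-subset of $\mathsf{clp}\,\mathbb X$, then $W$ is an $Ax$-subset of $\wp X$. Then there are functors - $\sigma:\mathrm{Alg}(N_{Ax})\to\mathrm{Alg}(L_{Ax})$, $(B,\Box)\mapsto(B^\sigma,\Box^\sigma)$, which sends a homomorphism $h$ to its complete extension (the inverse image under $h^{-1}$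 on ultrafilters); - $\Sigma_{Ax}:\mathrm{Coalg}(D_{Ax})\to\mathrm{Coalg}(B_{Ax})$, $(\mathbb X,\gamma)\mapsto(X,\ x\mapsto\gamma(x)^\sigma)$, and the forgetful functor $U_{Ax}:\mathrm{Coalg}(D^\sigma_{Ax})\to\mathrm{Coalg}(B_{Ax})$, $(\mathbb X,\gamma)\mapsto(X,\gamma)$, both the identity on the functions that underlie morphisms; and the following hold. 1. (Jónsson–Tarski type duality) The functor $\mathsf{clp}:\mathrm{Coalg}(D_{Ax})^{op}\to\mathrm{Alg}(N_{Ax})$, which sends $(\mathbb X,\gamma)$ to the algebra of clopens of $\mathbb X$ with $\Box a=\{x\mid a\in\gamma(x)\}$ and $f$ to $f^{-1}$, is an equivalence of categories. 2. (Thomason type duality) The functor $\wp:\mathrm{Coalg}(B_{Ax})^{op}\to\mathrm{Alg}(L_{Ax})$, which sends $(X,\gamma)$ to $\wp X$ with $\Box a=\{x\mid a\in\gamma(x)\}$ and $f$ to $f^{-1}$, is an equivalence of categories. 3. The square formed by these dualities, $\sigma$ and $\Sigma_{Ax}$ commutes up to natural isomorphism: $\sigma\circ\mathsf{clp}\cong\wp\circ\Sigma_{Ax}^{op}$.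 4. Composing structure maps with $W\mapsto W^\sigma$ is an isomorphism of categories $\mathrm{Coalg}(D_{Ax})\cong\mathrm{Coalg}(D^\sigma_{Ax})$. 5. The composite of this isomorphism with $U_{Ax}$ equals $\Sigma_{Ax}$. -/

import Mathlib

open CategoryTheory TopologicalSpace Opposite

universe u v

namespace NbhdDuality

/-! ### Formulas, axioms and validity -/

/-- Finitary Boolean formulas over a set `S` of atoms: `φ ::= s | ⊤ | ¬φ | φ ∧ φ`. -/
inductive Form (S : Type u) : Type u
  | var (s : S) : Form S
  | top : Form S
  | neg (φ : Form S) : Form S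
  | and (φ ψ : Form S) : Form S

namespace Form

/-- The value of a formula in a Boolean algebra, given the values of its atoms. -/
def eval {S : Type u} {C : Type v} [BooleanAlgebra C] (f : S → C) : Form S → C
  | var s => f s
  | top => ⊤
  | neg φ => (eval f φ)ᶜ
  | and φ ψ => eval f φ ⊓ eval f ψ

/-- Disjunction, as an abbreviation. -/
def or {S : Type u} (φ ψ : Form S) : Form S := neg (and (neg φ) (neg ψ))

/-- Implication, as an abbreviation. -/
def imp {S : Type u} (φ ψ : Form S) : Form S := neg (and φ (neg ψ))

theorem map_eval {S : Type*} {C D F : Type*} [BooleanAlgebra C] [BooleanAlgebra D]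
    [FunLike F C D] [BoundedLatticeHomClass F C D] (h : F) (f : S → C) (φ : Form S) :
    h (φ.eval f) = φ.eval (fun s => h (f s)) := by
  induction φ with
  | var s => rfl
  | top => exact map_top h
  | neg φ ih => simp only [eval, ← ih, map_compl']
  | and φ ψ ih₁ ih₂ => simp only [eval, ← ih₁, ← ih₂, map_inf]

theorem mem_eval {S X : Type*} (x : X) (f : S → Set X) (φ : Form S) :
    x ∈ φ.eval f ↔ φ.eval (fun s => x ∈ f s) := by
  induction φ with
  | var s => rfl
  | top => simp [eval]
  | neg φ ih => simp [eval, ih]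
  | and φ ψ ih₁ ih₂ => simp [eval, ih₁, ih₂]

end Form

/-- Finitary one-step formulas: Boolean combinations of formulas `□π`, where `π` is a box-free
formula in the variables `v₀, v₁, v₂, …`. -/
abbrev OneStep : Type := Form (Form ℕ)

/-- The one-step formula `□π`. -/
def box (π : Form ℕ) : OneStep := Form.var π

/-- The convexity axiom `□(v ∧ v') ∧ □(v ∨ v'') → □v`. -/
def convAx : OneStep :=
  Form.imp
    (Form.and (box (Form.and (Form.var 0) (Form.var 1))) (box (Form.or (Form.var 0) (Form.var 2))))
    (box (Form.var 0))

/-- The interpretation `f : B → C` of the modality, from a Boolean algebra of arguments to a Boolean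
algebra of values, makes the one-step formula `φ` true under every assignment of the variables in
`B`: in `φ`, each `□π` takes the value `f (θ̂ π)`. -/
def Satisfies {B : Type u} {C : Type v} [BooleanAlgebra B] [BooleanAlgebra C] (f : B → C)
    (φ : OneStep) : Prop :=
  ∀ θ : ℕ → B, φ.eval (fun π => f (π.eval θ)) = ⊤

/-- `Ax` implies `ψ`: every neighborhood algebra `(B, □)` that validates `Ax` validates `ψ`. -/
def Implies (Ax : Set OneStep) (ψ : OneStep) : Prop :=
  ∀ (B : Type u) [BooleanAlgebra B] (dbox : B → B),
    (∀ φ ∈ Ax, Satisfies dbox φ) → Satisfies dbox ψ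

/-- The set `θᵗ(φ)` of subsets of `B`, with `θᵗ(□π) = {W | θ̂ π ∈ W}`. -/
def truthSet {B : Type u} [BooleanAlgebra B] (θ : ℕ → B) (φ : OneStep) : Set (Set B) :=
  φ.eval (fun π => {W | π.eval θ ∈ W})

/-- `W` is an `Ax`-subset of `B`. -/
def IsAxSubset (Ax : Set OneStep) {B : Type u} [BooleanAlgebra B] (W : Set B) : Prop :=
  ∀ φ ∈ Ax, ∀ θ : ℕ → B, W ∈ truthSet θ φ

theorem mem_truthSet {B : Type u} [BooleanAlgebra B] (θ : ℕ → B) (φ : OneStep) (W : Set B) :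
    W ∈ truthSet θ φ ↔ φ.eval (fun π => π.eval θ ∈ W) := by
  unfold truthSet
  rw [Form.mem_eval]
  rfl

theorem mem_truthSet_preimage {B : Type u} {B' : Type v} [BooleanAlgebra B] [BooleanAlgebra B']
    (g : BoundedLatticeHom B B') (θ : ℕ → B) (φ : OneStep) (W : Set B') :
    g ⁻¹' W ∈ truthSet θ φ ↔ W ∈ truthSet (fun n => g (θ n)) φ := by
  simp only [mem_truthSet, Set.mem_preimage, Form.map_eval]

theorem IsAxSubset.preimage {Ax : Set OneStep} {B : Type u} {B' : Type v} [BooleanAlgebra B]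
    [BooleanAlgebra B'] (g : BoundedLatticeHom B B') {W : Set B'} (hW : IsAxSubset Ax W) :
    IsAxSubset Ax (g ⁻¹' W) :=
  fun φ hφ θ => (mem_truthSet_preimage g θ φ W).2 (hW φ hφ _)

theorem IsAxSubset.of_preimage {Ax : Set OneStep} {B : Type u} {B' : Type v} [BooleanAlgebra B]
    [BooleanAlgebra B'] (g : BoundedLatticeHom B B') (hg : Function.Surjective g) {W : Set B'}
    (hW : IsAxSubset Ax (g ⁻¹' W)) : IsAxSubset Ax W := by
  intro φ hφ θ
  choose θ' hθ' using fun n => hg (θ n)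
  have := (mem_truthSet_preimage g θ' φ W).1 (hW φ hφ θ')
  rwa [funext hθ'] at this

theorem satisfies_set_iff {Ax : Set OneStep} {B : Type u} {X : Type v} [BooleanAlgebra B]
    (f : B → Set X) :
    (∀ φ ∈ Ax, Satisfies f φ) ↔ ∀ x, IsAxSubset Ax {b | x ∈ f b} := by
  constructor
  · intro h x φ hφ θ
    rw [mem_truthSet]
    have := h φ hφ θ
    have hx : x ∈ φ.eval (fun π => f (π.eval θ)) := by rw [this]; trivial
    rwa [Form.mem_eval] at hx
  · intro h φ hφ θ
    refine Set.eq_univ_of_forall fun x => ?_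
    rw [Form.mem_eval]
    exact (mem_truthSet _ _ _).1 (h x φ hφ θ)

/-- If `Ax` implies convexity, then `Ax`-subsets are convex. -/
theorem IsAxSubset.convex {Ax : Set OneStep} (h : Implies.{u} Ax convAx) {B : Type u}
    [BooleanAlgebra B] {W : Set B} (hW : IsAxSubset Ax W) {a b c : B} (ha : a ∈ W) (hc : c ∈ W)
    (hab : a ≤ b) (hbc : b ≤ c) : b ∈ W := by
  classical
  rcases subsingleton_or_nontrivial B with hB | hB
  · rwa [Subsingleton.elim b a]
  let dbox : B → B := fun b => if b ∈ W then ⊤ else ⊥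
  have key : ∀ (φ : OneStep) (θ : ℕ → B), φ.eval (fun π => dbox (π.eval θ)) =
      if φ.eval (fun π => π.eval θ ∈ W) then ⊤ else ⊥ := by
    intro φ θ
    induction φ with
    | var s => rfl
    | top => simp [Form.eval]
    | neg φ ih => simp only [Form.eval, ih]; split_ifs <;> simp_all
    | and φ ψ ih₁ ih₂ => simp only [Form.eval, ih₁, ih₂]; split_ifs <;> simp_all
  have h1 : Satisfies dbox convAx := h B dbox fun φ hφ θ => by
    rw [key, if_pos ((mem_truthSet _ _ _).1 (hW φ hφ θ))]
  have h2 := h1 (fun n => if n = 0 then b else if n = 1 then a else c)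
  rw [key] at h2
  by_contra hb
  have e1 : b ⊓ a = a := inf_eq_right.2 hab
  have e2 : (bᶜ ⊓ cᶜ)ᶜ = c := by rw [compl_inf, compl_compl, compl_compl, sup_eq_right.2 hbc]
  simp [convAx, Form.imp, Form.or, box, Form.eval, hb, e1, e2, ha, hc] at h2

/-! ### Free Boolean algebras and presentations by generators and relations -/

/-- Two Boolean terms over `S` are identified if they agree in all Boolean algebras. -/
def freeSetoid (S : Type u) : Setoid (Form S) where
  r s t := ∀ (C : Type u) [BooleanAlgebra C] (f : S → C), s.eval f = t.eval f
  iseqv := ⟨fun _ _ _ _ => rfl, fun h C _ f => (h C f).symm,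
    fun h h' C _ f => (h C f).trans (h' C f)⟩

/-- The free Boolean algebra generated by the set `S`: Boolean terms over `S`, modulo the identities
that hold in all Boolean algebras. -/
def FreeBA (S : Type u) : Type u := Quotient (freeSetoid S)

namespace FreeBA

variable {S : Type u}

/-- The class of a term. -/
def mk (t : Form S) : FreeBA S := Quotient.mk (freeSetoid S) t

theorem mk_surjective : Function.Surjective (mk (S := S)) := Quotient.exists_rep

instance : Top (FreeBA S) := ⟨mk Form.top⟩
instance : Compl (FreeBA S) :=
  ⟨Quotient.map (sa := freeSetoid S) (sb := freeSetoid S) Form.neg fun _ _ h C _ f => by simp only [Form.eval, h C f]⟩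
instance : Min (FreeBA S) :=
  ⟨Quotient.map₂ (sa := freeSetoid S) (sb := freeSetoid S) (sc := freeSetoid S) Form.and fun _ _ h _ _ h' C _ f => by simp only [Form.eval, h C f, h' C f]⟩

/-- The evaluation of the elements of the free Boolean algebra. -/
def ev {C : Type u} [BooleanAlgebra C] (f : S → C) : FreeBA S → C :=
  Quotient.lift (s := freeSetoid S) (Form.eval f) fun _ _ h => h C f

theorem ext_ev {s t : FreeBA S}
    (h : ∀ (C : Type u) [BooleanAlgebra C] (f : S → C), ev f s = ev f t) : s = t := by
  obtain ⟨s, rfl⟩ := mk_surjective s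
  obtain ⟨t, rfl⟩ := mk_surjective t
  exact Quotient.sound (s := freeSetoid S) h

@[simp] theorem ev_top {C : Type u} [BooleanAlgebra C] (f : S → C) : ev f ⊤ = ⊤ := rfl
@[simp] theorem ev_compl {C : Type u} [BooleanAlgebra C] (f : S → C) (s : FreeBA S) :
    ev f sᶜ = (ev f s)ᶜ := by
  obtain ⟨s, rfl⟩ := mk_surjective s; rfl
@[simp] theorem ev_inf {C : Type u} [BooleanAlgebra C] (f : S → C) (s t : FreeBA S) :
    ev f (s ⊓ t) = ev f s ⊓ ev f t := by
  obtain ⟨s, rfl⟩ := mk_surjective s; obtain ⟨t, rfl⟩ := mk_surjective t; rfl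

theorem ev_le {s t : FreeBA S} (h : s ⊓ t = s) {C : Type u} [BooleanAlgebra C] (f : S → C) :
    ev f s ≤ ev f t := by
  rw [← h, ev_inf]; exact inf_le_right

instance : BooleanAlgebra (FreeBA S) where
  le s t := s ⊓ t = s
  le_refl s := ext_ev fun C _ f => by simp
  le_trans r s t h h' := ext_ev fun C _ f => by
    rw [ev_inf, inf_eq_left]; exact (ev_le h f).trans (ev_le h' f)
  le_antisymm s t h h' := ext_ev fun C _ f => le_antisymm (ev_le h f) (ev_le h' f)
  inf s t := s ⊓ t
  inf_le_left s t := ext_ev fun C _ f => by simp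
  inf_le_right s t := ext_ev fun C _ f => by simp
  le_inf r s t h h' := ext_ev fun C _ f => by
    rw [ev_inf, ev_inf, inf_eq_left]; exact le_inf (ev_le h f) (ev_le h' f)
  sup s t := (sᶜ ⊓ tᶜ)ᶜ
  le_sup_left s t := ext_ev fun C _ f => by simp
  le_sup_right s t := ext_ev fun C _ f => by simp
  sup_le r s t h h' := ext_ev fun C _ f => by
    have := sup_le (ev_le h f) (ev_le h' f)
    simpa using this
  le_sup_inf r s t := ext_ev fun C _ f => by
    change ev f (((rᶜ ⊓ sᶜ)ᶜ ⊓ (rᶜ ⊓ tᶜ)ᶜ) ⊓ (rᶜ ⊓ (s ⊓ t)ᶜ)ᶜ) = ev f ((rᶜ ⊓ sᶜ)ᶜ ⊓ (rᶜ ⊓ tᶜ)ᶜ)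
    simp [← sup_inf_left]
  top := ⊤
  le_top s := ext_ev fun C _ f => by simp
  bot := ⊤ᶜ
  bot_le s := ext_ev fun C _ f => by simp
  inf_compl_le_bot s := ext_ev fun C _ f => by
    change ev f ((s ⊓ sᶜ) ⊓ ⊤ᶜ) = ev f (s ⊓ sᶜ)
    simp
  top_le_sup_compl s := ext_ev fun C _ f => by
    change ev f (⊤ ⊓ (sᶜ ⊓ sᶜᶜ)ᶜ) = ev f ⊤
    simp

/-- The generators of the free Boolean algebra. -/
def gen (s : S) : FreeBA S := mk (Form.var s)

/-- The homomorphism that extends a map on generators. -/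
def lift {C : Type u} [BooleanAlgebra C] (f : S → C) : BoundedLatticeHom (FreeBA S) C where
  toFun := ev f
  map_inf' := ev_inf f
  map_top' := rfl
  map_bot' := (ev_compl f ⊤).trans (by simp)
  map_sup' s t := (ev_compl f _).trans (by simp)

@[simp] theorem lift_gen {C : Type u} [BooleanAlgebra C] (f : S → C) (s : S) :
    lift f (gen s) = f s := rfl

theorem hom_ext {C : Type v} [BooleanAlgebra C] {g h : BoundedLatticeHom (FreeBA S) C}
    (H : ∀ s, g (gen s) = h (gen s)) : g = h := by
  have key : ∀ (k : BoundedLatticeHom (FreeBA S) C) (t : Form S),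
      k (mk t) = t.eval (fun s => k (gen s)) := by
    intro k t
    induction t with
    | var s => rfl
    | top => exact map_top k
    | neg φ ih => exact (map_compl' k (mk φ)).trans (congrArg (·ᶜ) ih)
    | and φ ψ ih₁ ih₂ => exact (k.map_inf' (mk φ) (mk ψ)).trans (congrArg₂ (· ⊓ ·) ih₁ ih₂)
  ext t
  obtain ⟨t, rfl⟩ := mk_surjective t
  rw [key, key, funext H]

end FreeBA

/-- A congruence on a Boolean algebra. -/
structure IsCongruence {A : Type u} [BooleanAlgebra A] (r : A → A → Prop) : Prop where
  equiv : Equivalence r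
  compl : ∀ {a b}, r a b → r aᶜ bᶜ
  inf : ∀ {a b c d}, r a b → r c d → r (a ⊓ c) (b ⊓ d)

theorem IsCongruence.ker {A : Type u} {C : Type v} [BooleanAlgebra A] [BooleanAlgebra C]
    (h : BoundedLatticeHom A C) : IsCongruence fun a b => h a = h b where
  equiv := ⟨fun _ => rfl, fun h => h.symm, fun h h' => h.trans h'⟩
  compl h' := by rw [map_compl', map_compl', h']
  inf h' h'' := by rw [map_inf, map_inf, h', h'']

/-- The congruence generated by a set of equations. -/
def congrGen {A : Type u} [BooleanAlgebra A] (R : Set (A × A)) (a b : A) : Prop :=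
  ∀ r : A → A → Prop, IsCongruence r → (∀ p ∈ R, r p.1 p.2) → r a b

theorem congrGen_isCongruence {A : Type u} [BooleanAlgebra A] (R : Set (A × A)) :
    IsCongruence (congrGen R) where
  equiv := ⟨fun a _ hr _ => hr.equiv.refl a, fun h r hr hR => hr.equiv.symm (h r hr hR),
    fun h h' r hr hR => hr.equiv.trans (h r hr hR) (h' r hr hR)⟩
  compl h r hr hR := hr.compl (h r hr hR)
  inf h h' r hr hR := hr.inf (h r hr hR) (h' r hr hR)

/-- The quotient of a Boolean algebra by a congruence. -/
def BAQuot {A : Type u} [BooleanAlgebra A] {r : A → A → Prop} (hr : IsCongruence r) : Type u :=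
  Quotient (⟨r, hr.equiv⟩ : Setoid A)

namespace BAQuot

variable {A : Type u} [BooleanAlgebra A] {r : A → A → Prop} {hr : IsCongruence r}

/-- The quotient map. -/
def proj (hr : IsCongruence r) (a : A) : BAQuot hr := Quotient.mk _ a

theorem proj_surjective : Function.Surjective (proj hr) := Quotient.exists_rep

theorem proj_eq_iff {a b : A} : proj hr a = proj hr b ↔ r a b :=
  Quotient.eq (r := ⟨r, hr.equiv⟩)

instance : Top (BAQuot hr) := ⟨proj hr ⊤⟩
instance : Compl (BAQuot hr) :=
  ⟨Quotient.map (·ᶜ) fun _ _ h => hr.compl h⟩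
instance : Min (BAQuot hr) :=
  ⟨Quotient.map₂ (· ⊓ ·) fun _ _ h _ _ h' => hr.inf h h'⟩

theorem proj_compl (a : A) : (proj hr a)ᶜ = proj hr aᶜ := rfl
theorem proj_inf (a b : A) : proj hr a ⊓ proj hr b = proj hr (a ⊓ b) := rfl

theorem inf_comm' (x y : BAQuot hr) : x ⊓ y = y ⊓ x := by
  obtain ⟨a, rfl⟩ := proj_surjective x
  obtain ⟨b, rfl⟩ := proj_surjective y
  rw [proj_inf, proj_inf, inf_comm]

theorem inf_assoc' (x y z : BAQuot hr) : x ⊓ y ⊓ z = x ⊓ (y ⊓ z) := by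
  obtain ⟨a, rfl⟩ := proj_surjective x
  obtain ⟨b, rfl⟩ := proj_surjective y
  obtain ⟨c, rfl⟩ := proj_surjective z
  simp only [proj_inf, inf_assoc]

theorem sup_of_le {x y : BAQuot hr} (h : x ⊓ y = x) : (xᶜ ⊓ yᶜ)ᶜ = y := by
  obtain ⟨a, rfl⟩ := proj_surjective x
  obtain ⟨b, rfl⟩ := proj_surjective y
  rw [← h]
  simp [proj_inf, proj_compl]

theorem le_of_sup {x y : BAQuot hr} (h : (xᶜ ⊓ yᶜ)ᶜ = y) : x ⊓ y = x := by
  obtain ⟨a, rfl⟩ := proj_surjective x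
  obtain ⟨b, rfl⟩ := proj_surjective y
  rw [← h]
  simp [proj_inf, proj_compl]

instance : BooleanAlgebra (BAQuot hr) where
  le x y := x ⊓ y = x
  le_refl x := by
    obtain ⟨a, rfl⟩ := proj_surjective x
    rw [proj_inf, inf_idem]
  le_trans x y z h h' := by
    rw [← h, inf_assoc', h']
  le_antisymm x y h h' := by
    rw [← h, inf_comm', h']
  inf x y := x ⊓ y
  inf_le_left x y := by
    obtain ⟨a, rfl⟩ := proj_surjective x
    obtain ⟨b, rfl⟩ := proj_surjective y
    simp [proj_inf]
  inf_le_right x y := by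
    obtain ⟨a, rfl⟩ := proj_surjective x
    obtain ⟨b, rfl⟩ := proj_surjective y
    simp [proj_inf]
  le_inf x y z h h' := by
    rw [← inf_assoc', h, h']
  sup x y := (xᶜ ⊓ yᶜ)ᶜ
  le_sup_left x y := by
    obtain ⟨a, rfl⟩ := proj_surjective x
    obtain ⟨b, rfl⟩ := proj_surjective y
    simp [proj_inf, proj_compl]
  le_sup_right x y := by
    obtain ⟨a, rfl⟩ := proj_surjective x
    obtain ⟨b, rfl⟩ := proj_surjective y
    simp [proj_inf, proj_compl]
  sup_le x y z h h' := by
    apply le_of_sup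
    have h1 := sup_of_le h
    have h2 := sup_of_le h'
    obtain ⟨a, rfl⟩ := proj_surjective x
    obtain ⟨b, rfl⟩ := proj_surjective y
    obtain ⟨c, rfl⟩ := proj_surjective z
    rw [← h1, ← h2]
    simp only [proj_inf, proj_compl, compl_inf, compl_compl] at h1 h2 ⊢
    simp only [sup_left_comm, sup_comm, sup_left_idem]
  le_sup_inf x y z := by
    obtain ⟨a, rfl⟩ := proj_surjective x
    obtain ⟨b, rfl⟩ := proj_surjective y
    obtain ⟨c, rfl⟩ := proj_surjective z
    change ((((proj hr a)ᶜ ⊓ (proj hr b)ᶜ)ᶜ ⊓ ((proj hr a)ᶜ ⊓ (proj hr c)ᶜ)ᶜ) ⊓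
      ((proj hr a)ᶜ ⊓ (proj hr b ⊓ proj hr c)ᶜ)ᶜ) =
        (((proj hr a)ᶜ ⊓ (proj hr b)ᶜ)ᶜ ⊓ ((proj hr a)ᶜ ⊓ (proj hr c)ᶜ)ᶜ)
    simp [proj_inf, proj_compl, ← sup_inf_left]
  top := ⊤
  le_top x := by
    obtain ⟨a, rfl⟩ := proj_surjective x
    exact (proj_inf a ⊤).trans (by simp)
  bot := ⊤ᶜ
  bot_le x := by
    obtain ⟨a, rfl⟩ := proj_surjective x
    change proj hr ⊤ᶜ ⊓ proj hr a = proj hr ⊤ᶜ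
    simp [proj_inf]
  inf_compl_le_bot x := by
    obtain ⟨a, rfl⟩ := proj_surjective x
    change proj hr a ⊓ proj hr aᶜ ⊓ proj hr ⊤ᶜ = proj hr a ⊓ proj hr aᶜ
    simp [proj_inf]
  top_le_sup_compl x := by
    obtain ⟨a, rfl⟩ := proj_surjective x
    change proj hr ⊤ ⊓ ((proj hr a)ᶜ ⊓ (proj hr a)ᶜᶜ)ᶜ = proj hr ⊤
    simp [proj_inf, proj_compl]

/-- The quotient map as a homomorphism. -/
def projHom (hr : IsCongruence r) : BoundedLatticeHom A (BAQuot hr) where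
  toFun := proj hr
  map_inf' _ _ := rfl
  map_top' := rfl
  map_bot' := congrArg (proj hr) compl_top.symm
  map_sup' a b := congrArg (proj hr) (show a ⊔ b = (aᶜ ⊓ bᶜ)ᶜ by simp)

/-- A homomorphism whose kernel contains the congruence factors through the quotient. -/
def lift {C : Type v} [BooleanAlgebra C] (h : BoundedLatticeHom A C)
    (H : ∀ a b, r a b → h a = h b) : BoundedLatticeHom (BAQuot hr) C where
  toFun := Quotient.lift (s := ⟨r, hr.equiv⟩) h H
  map_inf' x y := by
    obtain ⟨a, rfl⟩ := proj_surjective x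
    obtain ⟨b, rfl⟩ := proj_surjective y
    exact map_inf h a b
  map_sup' x y := by
    obtain ⟨a, rfl⟩ := proj_surjective x
    obtain ⟨b, rfl⟩ := proj_surjective y
    exact (congrArg h (show (aᶜ ⊓ bᶜ)ᶜ = a ⊔ b by simp)).trans (map_sup h a b)
  map_top' := map_top h
  map_bot' := (congrArg h compl_top).trans (map_bot h)

end BAQuot

/-- The equations `θ̄(φ) = 1` between elements of the free Boolean algebra generated by
`{□b | b ∈ B}`, for `φ ∈ Ax` and `θ` an assignment of the variables in `B`. -/
def nRel (Ax : Set OneStep) (B : Type u) [BooleanAlgebra B] : Set (FreeBA B × FreeBA B) :=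
  {p | ∃ φ ∈ Ax, ∃ θ : ℕ → B, p = (φ.eval (fun π => FreeBA.gen (π.eval θ)), ⊤)}

/-- The Boolean algebra freely generated by `{□b | b ∈ B}` modulo the congruence generated by the
equations `θ̄(φ) = 1`, for `φ ∈ Ax`. -/
abbrev NObj (Ax : Set OneStep) (B : Type u) [BooleanAlgebra B] : Type u :=
  BAQuot (congrGen_isCongruence (nRel Ax B))

namespace NObj

variable {Ax : Set OneStep} {B : Type u} [BooleanAlgebra B]

/-- The generator `□b`. -/
def gen (Ax : Set OneStep) (b : B) : NObj Ax B := BAQuot.projHom _ (FreeBA.gen b)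

theorem gen_satisfies : ∀ φ ∈ Ax, Satisfies (gen Ax : B → NObj Ax B) φ := by
  intro φ hφ θ
  rw [show (fun π : Form ℕ => gen Ax (π.eval θ)) =
    fun π => BAQuot.projHom _ (FreeBA.gen (π.eval θ)) from rfl, ← Form.map_eval]
  exact BAQuot.proj_eq_iff.2 fun _ _ hR => hR (_, ⊤) ⟨φ, hφ, θ, rfl⟩

/-- The homomorphism determined by its action on the generators. -/
def lift {C : Type u} [BooleanAlgebra C] (f : B → C) (hf : ∀ φ ∈ Ax, Satisfies f φ) :
    BoundedLatticeHom (NObj Ax B) C :=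
  BAQuot.lift (FreeBA.lift f) fun a b hab =>
    hab (fun a b => FreeBA.lift f a = FreeBA.lift f b) (IsCongruence.ker _) (by
      rintro _ ⟨φ, hφ, θ, rfl⟩
      rw [Form.map_eval, map_top]
      exact hf φ hφ θ)

@[simp] theorem lift_gen {C : Type u} [BooleanAlgebra C] (f : B → C)
    (hf : ∀ φ ∈ Ax, Satisfies f φ) (b : B) : lift f hf (gen Ax b) = f b := rfl

theorem hom_ext {C : Type v} [BooleanAlgebra C] {g h : BoundedLatticeHom (NObj Ax B) C}
    (H : ∀ b, g (gen Ax b) = h (gen Ax b)) : g = h := by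
  have : g.comp (BAQuot.projHom _) = h.comp (BAQuot.projHom _) := FreeBA.hom_ext H
  ext x
  obtain ⟨a, rfl⟩ := BAQuot.proj_surjective x
  exact DFunLike.congr_fun this a

end NObj

theorem Satisfies.comp {B : Type u} {B' C : Type*} [BooleanAlgebra B] [BooleanAlgebra B']
    [BooleanAlgebra C] {f : B' → C} {φ : OneStep} (hf : Satisfies f φ)
    (h : BoundedLatticeHom B B') : Satisfies (fun b => f (h b)) φ := fun θ => by
  simpa only [Form.map_eval] using hf (fun n => h (θ n))

theorem Satisfies.map {B : Type u} {C D : Type*} [BooleanAlgebra B] [BooleanAlgebra C]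
    [BooleanAlgebra D] {f : B → C} {φ : OneStep} (hf : Satisfies f φ)
    (h : BoundedLatticeHom C D) : Satisfies (fun b => h (f b)) φ := fun θ => by
  rw [← Form.map_eval, hf θ, map_top]

/-- The endofunctor `N_Ax` of Boolean algebras, with `N_Ax h (□b) = □(h b)`. -/
def NAx (Ax : Set OneStep) : BoolAlg.{u} ⥤ BoolAlg.{u} where
  obj B := BoolAlg.of (NObj Ax B)
  map h := BoolAlg.ofHom
    (NObj.lift (fun b => NObj.gen Ax (h.hom b))
      fun φ hφ => (NObj.gen_satisfies φ hφ).comp h.hom)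
  map_id _ := BoolAlg.hom_ext (NObj.hom_ext fun _ => rfl)
  map_comp _ _ := BoolAlg.hom_ext (NObj.hom_ext fun _ => rfl)

/-! ### Complete atomic Boolean algebras -/

/-- A complete congruence on a complete atomic Boolean algebra. -/
structure IsCompleteCongruence {A : Type u} [CompleteAtomicBooleanAlgebra A] (r : A → A → Prop) :
    Prop where
  equiv : Equivalence r
  compl : ∀ {a b}, r a b → r aᶜ bᶜ
  iInf : ∀ {ι : Type u} {a b : ι → A}, (∀ i, r (a i) (b i)) → r (⨅ i, a i) (⨅ i, b i)

theorem IsCompleteCongruence.isCongruence {A : Type u} [CompleteAtomicBooleanAlgebra A]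
    {r : A → A → Prop} (hr : IsCompleteCongruence r) : IsCongruence r where
  equiv := hr.equiv
  compl := hr.compl
  inf {a b c d} h h' := by
    have key : ∀ x y : A, (⨅ i : ULift.{u} Bool, bif i.down then x else y) = x ⊓ y := fun x y => by
      exact (Equiv.ulift.iInf_congr (g := fun i => bif i then x else y) fun _ => rfl).trans
        (inf_eq_iInf x y).symm
    rw [← key, ← key]
    exact hr.iInf fun ⟨i⟩ => by cases i <;> assumption

/-- The complete congruence generated by a set of equations. -/
def completeCongrGen {A : Type u} [CompleteAtomicBooleanAlgebra A] (R : Set (A × A)) (a b : A) :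
    Prop :=
  ∀ r : A → A → Prop, IsCompleteCongruence r → (∀ p ∈ R, r p.1 p.2) → r a b

theorem completeCongrGen_isCompleteCongruence {A : Type u} [CompleteAtomicBooleanAlgebra A]
    (R : Set (A × A)) : IsCompleteCongruence (completeCongrGen R) where
  equiv := ⟨fun a _ hr _ => hr.equiv.refl a, fun h r hr hR => hr.equiv.symm (h r hr hR),
    fun h h' r hr hR => hr.equiv.trans (h r hr hR) (h' r hr hR)⟩
  compl h r hr hR := hr.compl (h r hr hR)
  iInf h r hr hR := hr.iInf fun i => h i r hr hR

theorem IsCompleteCongruence.ker {A : Type u} {C : Type v} [CompleteAtomicBooleanAlgebra A]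
    [CompleteAtomicBooleanAlgebra C] (h : CompleteLatticeHom A C) :
    IsCompleteCongruence fun a b => h a = h b where
  equiv := ⟨fun _ => rfl, fun h => h.symm, fun h h' => h.trans h'⟩
  compl h' := by rw [map_compl', map_compl', h']
  iInf h' := by rw [map_iInf, map_iInf]; exact iInf_congr h'

/-- The quotient of a complete atomic Boolean algebra by a complete congruence. -/
def CABAQuot {A : Type u} [CompleteAtomicBooleanAlgebra A] {r : A → A → Prop}
    (hr : IsCompleteCongruence r) : Type u :=
  BAQuot hr.isCongruence

namespace CABAQuot

variable {A : Type u} [CompleteAtomicBooleanAlgebra A] {r : A → A → Prop}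
  {hr : IsCompleteCongruence r}

instance : BooleanAlgebra (CABAQuot hr) := inferInstanceAs (BooleanAlgebra (BAQuot hr.isCongruence))

/-- The quotient map. -/
def proj (hr : IsCompleteCongruence r) : BoundedLatticeHom A (CABAQuot hr) :=
  BAQuot.projHom hr.isCongruence

theorem proj_surjective : Function.Surjective (proj hr) := BAQuot.proj_surjective

theorem proj_eq_iff {a b : A} : proj hr a = proj hr b ↔ r a b := BAQuot.proj_eq_iff

theorem isGLB_proj {ι : Type u} (a : ι → A) :
    IsGLB (Set.range fun i => proj hr (a i)) (proj hr (⨅ i, a i)) := by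
  constructor
  · rintro _ ⟨i, rfl⟩
    exact OrderHomClass.mono (proj hr) (iInf_le a i)
  · intro x hx
    obtain ⟨c, rfl⟩ := proj_surjective x
    have h1 : ∀ i, r (c ⊓ a i) c := fun i => by
      rw [← proj_eq_iff (hr := hr), map_inf, inf_eq_left]
      exact hx ⟨i, rfl⟩
    have h2 := proj_eq_iff (hr := hr) |>.2 (hr.iInf h1)
    have h4 : c ⊓ (⨅ _ : ι, c) = c := inf_eq_left.2 (le_iInf fun _ => le_rfl)
    have h3 : c ⊓ (⨅ i, c ⊓ a i) = c ⊓ ⨅ i, a i := by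
      rw [iInf_inf_eq, ← inf_assoc, h4]
    rw [← inf_eq_left, ← map_inf, ← h3, map_inf, h2, ← map_inf, h4]

theorem isLUB_proj {ι : Type u} (a : ι → A) :
    IsLUB (Set.range fun i => proj hr (a i)) (proj hr (⨆ i, a i)) := by
  have h := isGLB_proj (hr := hr) fun i => (a i)ᶜ
  rw [← compl_iSup, map_compl'] at h
  constructor
  · rintro _ ⟨i, rfl⟩
    exact OrderHomClass.mono (proj hr) (le_iSup a i)
  · intro x hx
    have : xᶜ ≤ (proj hr (⨆ i, a i))ᶜ := h.2 (by
      rintro _ ⟨i, rfl⟩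
      change xᶜ ≤ proj hr (a i)ᶜ
      rw [map_compl']
      exact compl_le_compl (hx ⟨i, rfl⟩))
    exact compl_le_compl_iff_le.1 this

/-- A representative of an element of the quotient. -/
noncomputable def rep (x : CABAQuot hr) : A := (proj_surjective x).choose

theorem proj_rep (x : CABAQuot hr) : proj hr (rep x) = x := (proj_surjective x).choose_spec

noncomputable instance : CompleteLattice (CABAQuot hr) where
  __ := (inferInstance : BooleanAlgebra (CABAQuot hr))
  sInf s := proj hr (⨅ x : s, rep x.1)
  sSup s := proj hr (⨆ x : s, rep x.1)
  isGLB_sInf s := by simpa [proj_rep] using isGLB_proj (hr := hr) fun x : s => rep x.1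
  isLUB_sSup s := by simpa [proj_rep] using isLUB_proj (hr := hr) fun x : s => rep x.1

theorem proj_iInf {ι : Type u} (a : ι → A) : proj hr (⨅ i, a i) = ⨅ i, proj hr (a i) :=
  (isGLB_proj a).iInf_eq.symm

theorem proj_iSup {ι : Type u} (a : ι → A) : proj hr (⨆ i, a i) = ⨆ i, proj hr (a i) :=
  (isLUB_proj a).iSup_eq.symm

noncomputable instance : CompleteAtomicBooleanAlgebra (CABAQuot hr) where
  __ := (inferInstance : CompleteLattice (CABAQuot hr))
  __ := (inferInstance : BooleanAlgebra (CABAQuot hr))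
  iInf_iSup_eq f := by
    have h : f = fun a b => proj hr (rep (f a b)) := by
      funext a b; exact (proj_rep _).symm
    rw [h]
    simp only [← proj_iInf, ← proj_iSup]
    rw [iInf_iSup_eq]

/-- The quotient map as a complete homomorphism. -/
noncomputable def projHom (hr : IsCompleteCongruence r) : CompleteLatticeHom A (CABAQuot hr) where
  toFun := proj hr
  map_sInf' s := by rw [sInf_eq_iInf', proj_iInf, sInf_image']
  map_sSup' s := by rw [sSup_eq_iSup', proj_iSup, sSup_image']

theorem projHom_surjective : Function.Surjective (projHom hr) := proj_surjective

theorem projHom_eq_iff {a b : A} : projHom hr a = projHom hr b ↔ r a b := proj_eq_iff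

/-- A complete homomorphism whose kernel contains the complete congruence factors through the
quotient. -/
noncomputable def lift {C : Type v} [CompleteAtomicBooleanAlgebra C] (h : CompleteLatticeHom A C)
    (H : ∀ a b, r a b → h a = h b) : CompleteLatticeHom (CABAQuot hr) C where
  toFun x := h (rep x)
  map_sInf' s := by
    have h1 : ∀ a, h (rep (proj hr a)) = h a := fun a =>
      H _ _ (proj_eq_iff (hr := hr).1 (proj_rep _))
    change h (rep (proj hr (⨅ x : s, rep x.1))) = _
    rw [h1, map_iInf, sInf_image']
  map_sSup' s := by
    have h1 : ∀ a, h (rep (proj hr a)) = h a := fun a =>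
      H _ _ (proj_eq_iff (hr := hr).1 (proj_rep _))
    change h (rep (proj hr (⨆ x : s, rep x.1))) = _
    rw [h1, map_iSup, sSup_image']

@[simp] theorem lift_projHom {C : Type v} [CompleteAtomicBooleanAlgebra C]
    (h : CompleteLatticeHom A C) (H : ∀ a b, r a b → h a = h b) (a : A) :
    lift h H (projHom hr a) = h a :=
  H _ _ (proj_eq_iff (hr := hr).1 (proj_rep _))

end CABAQuot

/-- The category of complete atomic Boolean algebras and complete homomorphisms. -/
structure CABA where
  /-- Bundle a complete atomic Boolean algebra. -/
  of ::
  /-- The underlying type. -/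
  carrier : Type u
  [str : CompleteAtomicBooleanAlgebra carrier]

attribute [instance] CABA.str

instance : CoeSort CABA.{u} (Type u) := ⟨CABA.carrier⟩

instance : LargeCategory.{u} CABA.{u} where
  Hom A B := CompleteLatticeHom A B
  id A := CompleteLatticeHom.id A
  comp f g := CompleteLatticeHom.comp g f

/-- The free complete atomic Boolean algebra generated by the set `S`, in its concrete description
as the double powerset of `S`; see `FreeCABA.lift`, `FreeCABA.lift_gen` and `FreeCABA.hom_ext` for
its universal property. -/
abbrev FreeCABA (S : Type u) : Type u := Set (Set S)

namespace FreeCABA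

variable {S : Type u}

/-- The generators of the free complete atomic Boolean algebra. -/
def gen (s : S) : FreeCABA S := {W | s ∈ W}

section lift

variable {C : Type v} [CompleteAtomicBooleanAlgebra C] (f : S → C)

/-- The value of the atom `{W}`. -/
def cell (W : Set S) : C := (⨅ s ∈ W, f s) ⊓ ⨅ s ∈ Wᶜ, (f s)ᶜ

theorem cell_le {W : Set S} {s : S} (h : s ∈ W) : cell f W ≤ f s :=
  inf_le_left.trans (iInf₂_le s h)

theorem cell_le_compl {W : Set S} {s : S} (h : s ∉ W) : cell f W ≤ (f s)ᶜ :=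
  inf_le_right.trans (iInf₂_le (f := fun s _ => (f s)ᶜ) s h)

theorem disjoint_cell {W W' : Set S} (h : W ≠ W') : Disjoint (cell f W) (cell f W') := by
  obtain ⟨s, hs⟩ : ∃ s, ¬(s ∈ W ↔ s ∈ W') := by
    by_contra hc; push Not at hc; exact h (Set.ext hc)
  by_cases h1 : s ∈ W
  · have h2 : s ∉ W' := fun h2 => hs ⟨fun _ => h2, fun _ => h1⟩
    exact (disjoint_compl_right (a := f s)).mono (cell_le f h1) (cell_le_compl f h2)
  · have h2 : s ∈ W' := by by_contra h2; exact hs ⟨fun h => (h1 h).elim, fun h => (h2 h).elim⟩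
    exact (disjoint_compl_left (a := f s)).mono (cell_le_compl f h1) (cell_le f h2)

theorem iSup_cell : ⨆ W, cell f W = ⊤ := by
  classical
  have h : (⨅ s : S, ⨆ b : Bool, bif b then f s else (f s)ᶜ) = ⊤ := by
    rw [iInf_eq_top]
    intro s
    rw [iSup_bool_eq]
    exact sup_compl_eq_top
  rw [iInf_iSup_eq] at h
  rw [eq_top_iff, ← h]
  refine iSup_le fun g => le_iSup_of_le {s | g s = true} (le_inf ?_ ?_)
  · refine le_iInf₂ fun s hs => (iInf_le _ s).trans ?_
    rw [show g s = true from hs]; exact le_rfl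
  · refine le_iInf₂ fun s hs => (iInf_le _ s).trans ?_
    rw [show g s = false from Bool.eq_false_iff.2 hs]; exact le_rfl

theorem iSup_cell_compl (U : FreeCABA S) :
    (⨆ W ∈ Uᶜ, cell f W) = (⨆ W ∈ U, cell f W)ᶜ := by
  refine (IsCompl.compl_eq ⟨?_, ?_⟩).symm
  · refine disjoint_iSup₂_iff.2 fun W hW => (disjoint_iSup₂_iff.2 fun W' hW' => ?_).symm
    exact disjoint_cell f fun h => hW (h ▸ hW')
  · rw [codisjoint_iff, eq_top_iff, ← iSup_cell f]
    refine iSup_le fun W => ?_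
    by_cases hW : W ∈ U
    · exact le_sup_of_le_left (le_iSup₂_of_le W hW le_rfl)
    · exact le_sup_of_le_right (le_iSup₂_of_le W hW le_rfl)

theorem map_sSup_aux (𝒰 : Set (FreeCABA S)) :
    (⨆ W ∈ sSup 𝒰, cell f W) = sSup ((fun U : FreeCABA S => ⨆ W ∈ U, cell f W) '' 𝒰) := by
  rw [sSup_image]
  apply le_antisymm
  · refine iSup₂_le fun W hW => ?_
    obtain ⟨U, hU, hWU⟩ := hW
    exact le_iSup₂_of_le U hU (le_iSup₂_of_le W hWU le_rfl)
  · refine iSup₂_le fun U hU => iSup₂_le fun W hW => ?_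
    exact le_iSup₂_of_le W ⟨U, hU, hW⟩ le_rfl

/-- The complete homomorphism that extends a map on generators. -/
def lift : CompleteLatticeHom (FreeCABA S) C where
  toFun U := ⨆ W ∈ U, cell f W
  map_sSup' := map_sSup_aux f
  map_sInf' 𝒰 := by
    have h := iSup_cell_compl f (sSup (compl '' 𝒰))
    have e : (sSup (compl '' 𝒰))ᶜ = sInf 𝒰 := by
      rw [compl_sSup, iInf_image]; simp [sInf_eq_iInf]
    rw [e, map_sSup_aux] at h
    rw [h, Set.image_image, sSup_image, compl_iSup, sInf_image]
    refine iInf_congr fun U => ?_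
    rw [compl_iSup]
    refine iInf_congr fun _ => ?_
    rw [iSup_cell_compl, compl_compl]

@[simp] theorem lift_gen (s : S) : lift f (gen s) = f s := by
  apply le_antisymm
  · exact iSup₂_le fun W hW => cell_le f hW
  · rw [← compl_le_compl_iff_le]
    refine (iSup_cell_compl f (gen s)).symm.le.trans ?_
    exact iSup₂_le fun W hW => cell_le_compl f hW

end lift

theorem hom_ext {C : Type v} [CompleteAtomicBooleanAlgebra C]
    {g h : CompleteLatticeHom (FreeCABA S) C} (H : ∀ s, g (gen s) = h (gen s)) : g = h := by
  have h1 : ∀ W : Set S, ({W} : FreeCABA S) = (⨅ s : W, gen s.1) ⊓ ⨅ s : (Wᶜ : Set S), (gen s.1)ᶜ := by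
    intro W
    ext V
    simp only [Set.mem_singleton_iff, Set.inf_eq_inter, Set.iInf_eq_iInter, Set.mem_inter_iff,
      Set.mem_iInter, Set.mem_compl_iff, gen, Set.mem_ofPred_eq]
    constructor
    · rintro rfl; exact ⟨fun s => s.2, fun s => s.2⟩
    · rintro ⟨h, h'⟩
      ext s
      exact ⟨fun hs => by by_contra hW; exact h' ⟨s, hW⟩ hs, fun hs => h ⟨s, hs⟩⟩
  have h2 : ∀ U : FreeCABA S, U = ⨆ W : U, ({W.1} : FreeCABA S) := by
    intro U; ext V; simp
  ext U
  rw [h2 U, map_iSup, map_iSup]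
  refine iSup_congr fun W => ?_
  rw [h1]
  simp only [map_inf, map_iInf, map_compl', H]

end FreeCABA

/-- The equations `θ̄(φ) = 1` between elements of the free complete atomic Boolean algebra generated
by `{□a | a ∈ A}`, for `φ ∈ Ax` and `θ` an assignment of the variables in `A`. -/
def lRel (Ax : Set OneStep) (A : Type u) [BooleanAlgebra A] : Set (FreeCABA A × FreeCABA A) :=
  {p | ∃ φ ∈ Ax, ∃ θ : ℕ → A, p = (φ.eval (fun π => FreeCABA.gen (π.eval θ)), ⊤)}

/-- The complete atomic Boolean algebra freely generated by `{□a | a ∈ A}` modulo the complete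
congruence generated by the equations `θ̄(φ) = 1`, for `φ ∈ Ax`. -/
abbrev LObj (Ax : Set OneStep) (A : Type u) [BooleanAlgebra A] : Type u :=
  CABAQuot (completeCongrGen_isCompleteCongruence (lRel Ax A))

namespace LObj

variable {Ax : Set OneStep} {A : Type u} [BooleanAlgebra A]

/-- The generator `□a`. -/
noncomputable def gen (Ax : Set OneStep) (a : A) : LObj Ax A :=
  CABAQuot.projHom _ (FreeCABA.gen a)

theorem gen_satisfies : ∀ φ ∈ Ax, Satisfies (gen Ax : A → LObj Ax A) φ := by
  intro φ hφ θ
  rw [show (fun π : Form ℕ => gen Ax (π.eval θ)) =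
    fun π => CABAQuot.projHom _ (FreeCABA.gen (π.eval θ)) from rfl, ← Form.map_eval]
  rw [← map_top (CABAQuot.projHom (completeCongrGen_isCompleteCongruence (lRel Ax A)))]
  exact CABAQuot.projHom_eq_iff.2 fun _ _ hR => hR (_, ⊤) ⟨φ, hφ, θ, rfl⟩

/-- The complete homomorphism determined by its action on the generators. -/
noncomputable def lift {C : Type v} [CompleteAtomicBooleanAlgebra C] (f : A → C)
    (hf : ∀ φ ∈ Ax, Satisfies f φ) : CompleteLatticeHom (LObj Ax A) C :=
  CABAQuot.lift (FreeCABA.lift f) fun _ _ hab =>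
    hab (fun a b => FreeCABA.lift f a = FreeCABA.lift f b) (IsCompleteCongruence.ker _) (by
      rintro _ ⟨φ, hφ, θ, rfl⟩
      rw [Form.map_eval, map_top]
      simp only [FreeCABA.lift_gen]
      exact hf φ hφ θ)

@[simp] theorem lift_gen {C : Type v} [CompleteAtomicBooleanAlgebra C] (f : A → C)
    (hf : ∀ φ ∈ Ax, Satisfies f φ) (a : A) : lift f hf (gen Ax a) = f a :=
  (CABAQuot.lift_projHom _ _ _).trans (FreeCABA.lift_gen f a)

theorem hom_ext {C : Type v} [CompleteAtomicBooleanAlgebra C]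
    {g h : CompleteLatticeHom (LObj Ax A) C} (H : ∀ a, g (gen Ax a) = h (gen Ax a)) : g = h := by
  have : g.comp (CABAQuot.projHom _) = h.comp (CABAQuot.projHom _) := FreeCABA.hom_ext H
  ext x
  obtain ⟨a, rfl⟩ := CABAQuot.projHom_surjective x
  exact DFunLike.congr_fun this a

end LObj

/-- The homomorphism `L_Ax h`. -/
noncomputable def LObj.map (Ax : Set OneStep) {A A' : Type u} [CompleteAtomicBooleanAlgebra A]
    [CompleteAtomicBooleanAlgebra A'] (h : CompleteLatticeHom A A') :
    CompleteLatticeHom (LObj Ax A) (LObj Ax A') :=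
  LObj.lift (fun a => LObj.gen Ax (h a)) fun φ hφ =>
    (LObj.gen_satisfies φ hφ).comp h.toBoundedLatticeHom

@[simp] theorem LObj.map_gen (Ax : Set OneStep) {A A' : Type u} [CompleteAtomicBooleanAlgebra A]
    [CompleteAtomicBooleanAlgebra A'] (h : CompleteLatticeHom A A') (a : A) :
    LObj.map Ax h (LObj.gen Ax a) = LObj.gen Ax (h a) :=
  LObj.lift_gen _ _ a

theorem LObj.lift_comp_map (Ax : Set OneStep) {A A' : Type u} [CompleteAtomicBooleanAlgebra A]
    [CompleteAtomicBooleanAlgebra A'] (h : CompleteLatticeHom A A') {f : A → A} {f' : A' → A'}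
    (hf : ∀ φ ∈ Ax, Satisfies f φ) (hf' : ∀ φ ∈ Ax, Satisfies f' φ)
    (H : ∀ a, f' (h a) = h (f a)) :
    (LObj.lift f' hf').comp (LObj.map Ax h) = h.comp (LObj.lift f hf) :=
  LObj.hom_ext fun a => by simp [H]

/-- The endofunctor `L_Ax` of complete atomic Boolean algebras, with `L_Ax h (□a) = □(h a)`. -/
noncomputable def LAx (Ax : Set OneStep) : CABA.{u} ⥤ CABA.{u} where
  obj A := CABA.of (LObj Ax A)
  map h := LObj.map Ax h
  map_id A := LObj.hom_ext fun a => LObj.map_gen Ax (CompleteLatticeHom.id A) a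
  map_comp {A A' A''} (f : CompleteLatticeHom A A') (g : CompleteLatticeHom A' A'') := by
    change LObj.map Ax (g.comp f) = (LObj.map Ax g).comp (LObj.map Ax f)
    exact LObj.hom_ext fun a => by simp

/-! ### Neighborhood functors on sets and on Stone spaces -/

/-- The endofunctor `B_Ax` of sets: `B_Ax X` is the set of `Ax`-subsets of the powerset of `X`. -/
def BAx (Ax : Set OneStep) : Type u ⥤ Type u where
  obj X := {W : Set (Set X) // IsAxSubset Ax W}
  map {_ X'} f := TypeCat.ofHom fun W =>
    ⟨{a' : Set X' | f ⁻¹' a' ∈ W.1},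
      W.2.preimage (CompleteLatticeHom.setPreimage f).toBoundedLatticeHom⟩
  map_id _ := rfl
  map_comp _ _ := rfl

/-- The points of the hyperspace `D X`: sets of clopen subsets of `X`. -/
@[ext] structure DHyper (X : Type u) [TopologicalSpace X] : Type u where
  /-- The set of clopen sets. -/
  carrier : Set (Clopens X)

namespace DHyper

variable {X : Type u} [TopologicalSpace X]

/-- The topology on `D X`, generated by the sets `□a` and `◇a` for `a` clopen. -/
instance : TopologicalSpace (DHyper X) :=
  generateFrom ({U | ∃ a : Clopens X, U = {W | a ∈ W.carrier}} ∪
    {U | ∃ a : Clopens X, U = {W | aᶜ ∉ W.carrier}})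

theorem isClopen_box (a : Clopens X) : IsClopen {W : DHyper X | a ∈ W.carrier} := by
  constructor
  · rw [← isOpen_compl_iff]
    refine isOpen_generateFrom_of_mem (Or.inr ⟨aᶜ, ?_⟩)
    rw [compl_compl]; rfl
  · exact isOpen_generateFrom_of_mem (Or.inl ⟨a, rfl⟩)

theorem continuous_iff {Y : Type*} [TopologicalSpace Y] {g : Y → DHyper X} :
    Continuous g ↔ ∀ a, IsClopen {y | a ∈ (g y).carrier} := by
  constructor
  · exact fun hg a => (isClopen_box a).preimage hg
  · intro h
    refine continuous_generateFrom_iff.2 ?_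
    rintro _ (⟨a, rfl⟩ | ⟨a, rfl⟩)
    · exact (h a).isOpen
    · exact (h aᶜ).compl.isOpen

instance : CompactSpace (DHyper X) := by
  refine ⟨isCompact_iff_ultrafilter_le_nhds.2 fun F _ => ?_⟩
  refine ⟨⟨{a | {W : DHyper X | a ∈ W.carrier} ∈ F}⟩, trivial, ?_⟩
  rw [nhds_generateFrom]
  refine le_iInf₂ fun U hU => Filter.le_principal_iff.2 ?_
  obtain ⟨hU, ⟨a, rfl⟩ | ⟨a, rfl⟩⟩ := hU
  · exact hU
  · exact Ultrafilter.compl_mem_iff_notMem.2 hU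

instance : TotallySeparatedSpace (DHyper X) := by
  refine totallySeparatedSpace_iff_exists_isClopen.2 fun W W' h => ?_
  obtain ⟨a, ha⟩ : ∃ a, ¬(a ∈ W.carrier ↔ a ∈ W'.carrier) := by
    by_contra hc; push Not at hc; exact h (DHyper.ext (Set.ext hc))
  by_cases h1 : a ∈ W.carrier
  · exact ⟨_, isClopen_box a, h1, fun h2 => ha ⟨fun _ => h2, fun _ => h1⟩⟩
  · exact ⟨_, (isClopen_box a).compl, h1, fun h2 => ha ⟨fun h => (h1 h).elim, fun h => (h2 h).elim⟩⟩

theorem isClosed_isAxSubset (Ax : Set OneStep) :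
    IsClosed {W : DHyper X | IsAxSubset Ax W.carrier} := by
  have key : ∀ (φ : OneStep) (θ : ℕ → Clopens X),
      IsClopen {W : DHyper X | W.carrier ∈ truthSet θ φ} := by
    intro φ θ
    simp only [mem_truthSet]
    induction φ with
    | var π => exact isClopen_box _
    | top => exact isClopen_univ
    | neg φ ih => exact ih.compl
    | and φ ψ ih₁ ih₂ => exact ih₁.inter ih₂
  have : {W : DHyper X | IsAxSubset Ax W.carrier} =
      ⋂ (φ : OneStep) (_ : φ ∈ Ax) (θ : ℕ → Clopens X), {W | W.carrier ∈ truthSet θ φ} := by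
    ext W; simp [IsAxSubset]
  rw [this]
  exact isClosed_iInter fun φ => isClosed_iInter fun _ => isClosed_iInter fun θ => (key φ θ).isClosed

end DHyper

/-- The subspace of `D X` that consists of the `Ax`-subsets of the Boolean algebra of clopens. -/
abbrev DAxSpace (Ax : Set OneStep) (X : Type u) [TopologicalSpace X] : Type u :=
  {W : DHyper X // IsAxSubset Ax W.carrier}

instance (Ax : Set OneStep) (X : Type u) [TopologicalSpace X] : CompactSpace (DAxSpace Ax X) :=
  isCompact_iff_compactSpace.1 (DHyper.isClosed_isAxSubset Ax).isCompact

instance (Ax : Set OneStep) (X : Type u) [TopologicalSpace X] :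
    TotallySeparatedSpace (DAxSpace Ax X) :=
  totallySeparatedSpace_iff_exists_isClopen.2 fun W W' h => by
    obtain ⟨U, hU, h1, h2⟩ :=
      totallySeparatedSpace_iff_exists_isClopen.1 inferInstance (Subtype.val_injective.ne h)
    exact ⟨_, hU.preimage continuous_subtype_val, h1, h2⟩

/-- The inverse image of clopen sets along a continuous map. -/
def clopenComap {X Y : Type u} [TopologicalSpace X] [TopologicalSpace Y] (f : C(X, Y)) :
    BoundedLatticeHom (Clopens Y) (Clopens X) where
  toFun a := ⟨f ⁻¹' a, a.isClopen.preimage f.continuous⟩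
  map_sup' _ _ := rfl
  map_inf' _ _ := rfl
  map_top' := rfl
  map_bot' := rfl

/-- The endofunctor `D_Ax` of Stone spaces, with `D_Ax f W = {a' | f⁻¹(a') ∈ W}`. -/
def DAx (Ax : Set OneStep) : Profinite.{u} ⥤ Profinite.{u} where
  obj X := Profinite.of (DAxSpace Ax X)
  map {X X'} f := CompHausLike.ofHom _
    { toFun := fun W => (⟨⟨{a' : Clopens X' | clopenComap f.hom.hom a' ∈ W.1.carrier}⟩,
        W.2.preimage (clopenComap f.hom.hom)⟩ : DAxSpace Ax X')
      continuous_toFun := by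
        refine continuous_induced_rng.2 (DHyper.continuous_iff.2 fun a => ?_)
        exact (DHyper.isClopen_box (clopenComap f.hom.hom a)).preimage continuous_subtype_val }
  map_id _ := rfl
  map_comp _ _ := rfl

/-! ### The `σ`-extension of neighborhoods -/

section SigmaNbhds

variable {X : Type u} [TopologicalSpace X]

/-- The `σ`-extension of a set `W` of clopen sets: all sets `e` with `c ⊆ e ⊆ d` for some closed `c`
and open `d` such that `[c, d]` contains no clopen sets other than members of `W`. -/
def sigmaNbhds (W : Set (Clopens X)) : Set (Set X) :=
  {e | ∃ c d : Set X, IsClosed c ∧ IsOpen d ∧ c ⊆ e ∧ e ⊆ d ∧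
    ∀ a : Clopens X, c ⊆ a → (a : Set X) ⊆ d → a ∈ W}

theorem coe_mem_sigmaNbhds {W : Set (Clopens X)} {a : Clopens X} :
    (a : Set X) ∈ sigmaNbhds W ↔ a ∈ W := by
  constructor
  · rintro ⟨c, d, -, -, hc, hd, h⟩
    exact h a hc hd
  · intro ha
    refine ⟨a, a, a.isClopen.isClosed, a.isClopen.isOpen, le_rfl, le_rfl, fun b h h' => ?_⟩
    rwa [show b = a from SetLike.coe_injective (h'.antisymm h)]

theorem preimage_mem_sigmaNbhds {X' : Type u} [TopologicalSpace X'] [CompactSpace X]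
    [CompactSpace X'] [T2Space X'] [TotallyDisconnectedSpace X'] (f : C(X, X'))
    {W : Set (Clopens X)}
    (hW : ∀ {a b c : Clopens X}, a ∈ W → c ∈ W → a ≤ b → b ≤ c → b ∈ W) (e' : Set X') :
    f ⁻¹' e' ∈ sigmaNbhds W ↔ e' ∈ sigmaNbhds {a' | clopenComap f a' ∈ W} := by
  constructor
  · rintro ⟨c, d, hc, hd, hce, hed, h⟩
    refine ⟨f '' c, (f '' dᶜ)ᶜ, (hc.isCompact.image f.continuous).isClosed,
      (hd.isClosed_compl.isCompact.image f.continuous).isClosed.isOpen_compl,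
      Set.image_subset_iff.2 hce, ?_, fun a' h1 h2 => h _ (fun x hx => h1 ⟨x, hx, rfl⟩) ?_⟩
    · rintro y hy ⟨x, hx, rfl⟩
      exact hx (hed hy)
    · intro x hx
      by_contra hxd
      exact h2 hx ⟨x, hxd, rfl⟩
  · rintro ⟨c, d, hc, hd, hce, hed, h⟩
    refine ⟨f ⁻¹' c, f ⁻¹' d, hc.preimage f.continuous, hd.preimage f.continuous,
      Set.preimage_mono hce, Set.preimage_mono hed, fun a h1 h2 => ?_⟩
    have hcd := hce.trans hed
    obtain ⟨b₁, hb₁, hcb₁, hbd₁⟩ := exists_clopen_of_closed_subset_open hc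
      (hd.inter (a.isClopen.isOpen.isClosed_compl.isCompact.image f.continuous).isClosed.isOpen_compl)
      (by
        refine Set.subset_inter hcd ?_
        rintro y hy ⟨x, hx, rfl⟩
        exact hx (h1 hy))
    obtain ⟨b₂, hb₂, hcb₂, hbd₂⟩ := exists_clopen_of_closed_subset_open
      (hc.union (a.isClopen.isClosed.isCompact.image f.continuous).isClosed) hd
      (Set.union_subset hcd (Set.image_subset_iff.2 h2))
    refine hW (h ⟨b₁, hb₁⟩ hcb₁ (hbd₁.trans Set.inter_subset_left))
      (h ⟨b₂, hb₂⟩ (Set.subset_union_left.trans hcb₂) hbd₂) ?_ ?_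
    · intro x hx
      by_contra hxa
      exact (hbd₁ hx).2 ⟨x, hxa, rfl⟩
    · intro x hx
      exact hcb₂ (Or.inr ⟨x, hx, rfl⟩)

end SigmaNbhds

/-- The points of the hyperspace `D^σ X`: the sets `W` of subsets of `X` such that `e ∈ W` iff there
are a closed `c` and an open `d` with `c ⊆ e ⊆ d` and such that all clopens in `[c, d]` are in
`W`. -/
@[ext] structure DSigma (X : Type u) [TopologicalSpace X] : Type u where
  /-- The set of subsets. -/
  carrier : Set (Set X)
  mem_iff : ∀ e : Set X, e ∈ carrier ↔ ∃ c d : Set X, IsClosed c ∧ IsOpen d ∧ c ⊆ e ∧ e ⊆ d ∧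
    ∀ a : Clopens X, c ⊆ a → (a : Set X) ⊆ d → (a : Set X) ∈ carrier

namespace DSigma

variable {X : Type u} [TopologicalSpace X]

/-- The topology on `D^σ X`, generated by the sets `□a` and `◇a` for `a` clopen. -/
instance : TopologicalSpace (DSigma X) :=
  generateFrom ({U | ∃ a : Clopens X, U = {W | (a : Set X) ∈ W.carrier}} ∪
    {U | ∃ a : Clopens X, U = {W | (a : Set X)ᶜ ∉ W.carrier}})

/-- The set of clopens in `W`. -/
def trace (W : DSigma X) : Set (Clopens X) := {a | (a : Set X) ∈ W.carrier}

theorem carrier_eq (W : DSigma X) : W.carrier = sigmaNbhds W.trace := Set.ext W.mem_iff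

/-- The `σ`-extension of a set of clopens, as a point of `D^σ X`. -/
def ofTrace (W : Set (Clopens X)) : DSigma X where
  carrier := sigmaNbhds W
  mem_iff e := by simp only [coe_mem_sigmaNbhds]; rfl

theorem trace_ofTrace (W : Set (Clopens X)) : (ofTrace W).trace = W :=
  Set.ext fun _ => coe_mem_sigmaNbhds

theorem ofTrace_trace (W : DSigma X) : ofTrace W.trace = W := DSigma.ext W.carrier_eq.symm

theorem isClopen_box (a : Clopens X) : IsClopen {W : DSigma X | (a : Set X) ∈ W.carrier} := by
  constructor
  · rw [← isOpen_compl_iff]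
    refine isOpen_generateFrom_of_mem (Or.inr ⟨aᶜ, ?_⟩)
    rw [Clopens.coe_compl, compl_compl]; rfl
  · exact isOpen_generateFrom_of_mem (Or.inl ⟨a, rfl⟩)

theorem continuous_iff {Y : Type*} [TopologicalSpace Y] {g : Y → DSigma X} :
    Continuous g ↔ ∀ a : Clopens X, IsClopen {y | (a : Set X) ∈ (g y).carrier} := by
  constructor
  · exact fun hg a => (isClopen_box a).preimage hg
  · intro h
    refine continuous_generateFrom_iff.2 ?_
    rintro _ (⟨a, rfl⟩ | ⟨a, rfl⟩)
    · exact (h a).isOpen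
    · exact (h aᶜ).compl.isOpen

/-- `D^σ X` is homeomorphic to `D X`. -/
def homeo : DHyper X ≃ₜ DSigma X where
  toFun W := ofTrace W.carrier
  invFun W := ⟨W.trace⟩
  left_inv W := DHyper.ext (trace_ofTrace W.carrier)
  right_inv W := ofTrace_trace W
  continuous_toFun := continuous_iff.2 fun a => by
    have h : {W : DHyper X | (a : Set X) ∈ (ofTrace W.carrier).carrier} =
        {W : DHyper X | a ∈ W.carrier} := Set.ext fun W => coe_mem_sigmaNbhds
    rw [h]
    exact DHyper.isClopen_box a
  continuous_invFun := DHyper.continuous_iff.2 isClopen_box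

end DSigma

/-- The subspace of `D^σ X` that consists of the `Ax`-subsets, where the variables range over the
clopens. -/
abbrev DSigmaAxSpace (Ax : Set OneStep) (X : Type u) [TopologicalSpace X] : Type u :=
  {W : DSigma X // IsAxSubset Ax W.trace}

/-- The homeomorphism `W ↦ W^σ` from `D_Ax X` to `D^σ_Ax X`. -/
def sigmaHomeo (Ax : Set OneStep) (X : Type u) [TopologicalSpace X] :
    DAxSpace Ax X ≃ₜ DSigmaAxSpace Ax X :=
  (DSigma.homeo (X := X)).subtype (p := fun W : DHyper X => IsAxSubset Ax W.carrier)
      (q := fun W : DSigma X => IsAxSubset Ax W.trace) fun W => by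
    change _ ↔ IsAxSubset Ax (DSigma.ofTrace W.carrier).trace
    rw [DSigma.trace_ofTrace]

instance (Ax : Set OneStep) (X : Type u) [TopologicalSpace X] :
    CompactSpace (DSigmaAxSpace Ax X) := (sigmaHomeo Ax X).compactSpace

instance (Ax : Set OneStep) (X : Type u) [TopologicalSpace X] :
    T2Space (DSigmaAxSpace Ax X) := (sigmaHomeo Ax X).t2Space

instance (Ax : Set OneStep) (X : Type u) [TopologicalSpace X] :
    TotallyDisconnectedSpace (DSigmaAxSpace Ax X) := (sigmaHomeo Ax X).totallyDisconnectedSpace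

/-- The action of `D^σ_Ax` on a continuous map. -/
def DSigmaAx.mapFun {Ax : Set OneStep} (hConv : Implies.{u} Ax convAx) {X X' : Profinite.{u}}
    (f : C(X, X')) (W : DSigmaAxSpace Ax X) : DSigmaAxSpace Ax X' :=
  ⟨{ carrier := {w' : Set X' | f ⁻¹' w' ∈ W.1.carrier}
     mem_iff := fun e => by
      refine Iff.trans ?_ (preimage_mem_sigmaNbhds f (W := W.1.trace) (W.2.convex hConv) e)
      rw [← DSigma.carrier_eq]; rfl },
    W.2.preimage (clopenComap f)⟩

/-- The endofunctor `D^σ_Ax` of Stone spaces, with `D^σ_Ax f W = {w' | f⁻¹(w') ∈ W}`, when `Ax`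
implies convexity. -/
def DSigmaAx (Ax : Set OneStep) (hConv : Implies.{u} Ax convAx) : Profinite.{u} ⥤ Profinite.{u} where
  obj X := Profinite.of (DSigmaAxSpace Ax X)
  map {X X'} f := CompHausLike.ofHom _
    { toFun := DSigmaAx.mapFun hConv f.hom.hom
      continuous_toFun := by
        refine continuous_induced_rng.2 (DSigma.continuous_iff.2 fun a => ?_)
        exact (DSigma.isClopen_box (clopenComap f.hom.hom a)).preimage continuous_subtype_val }
  map_id _ := rfl
  map_comp _ _ := rfl

/-- The natural transformation `W ↦ W^σ` from `D_Ax` to `D^σ_Ax`. -/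
def sigmaTrans (Ax : Set OneStep) (hConv : Implies.{u} Ax convAx) : DAx Ax ⟶ DSigmaAx Ax hConv where
  app X := CompHausLike.ofHom _ ⟨sigmaHomeo Ax X, (sigmaHomeo Ax X).continuous⟩
  naturality X X' f := by
    ext W
    refine Subtype.ext (DSigma.ext (Set.ext fun e => ?_))
    exact (preimage_mem_sigmaNbhds f.hom.hom (W.2.convex hConv) e).symm

/-! ### Ultrafilters and canonical extensions -/

/-- An ultrafilter of a Boolean algebra. -/
@[ext] structure Ult (B : Type u) [BooleanAlgebra B] : Type u where
  /-- The elements of the ultrafilter. -/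
  carrier : Set B
  top_mem : ⊤ ∈ carrier
  inf_mem : ∀ {a b}, a ∈ carrier → b ∈ carrier → a ⊓ b ∈ carrier
  mem_of_le : ∀ {a b}, a ∈ carrier → a ≤ b → b ∈ carrier
  compl_mem_iff : ∀ {a}, aᶜ ∈ carrier ↔ a ∉ carrier

namespace Ult

section

variable {B : Type u} [BooleanAlgebra B]

/-- The set of ultrafilters that contain `b`, as a Boolean homomorphism. -/
def stone (B : Type u) [BooleanAlgebra B] : BoundedLatticeHom B (Set (Ult B)) where
  toFun b := {x | b ∈ x.carrier}
  map_top' := Set.eq_univ_of_forall fun x => x.top_mem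
  map_bot' := Set.eq_empty_of_forall_notMem fun x hx =>
    x.compl_mem_iff.1 (by rw [compl_bot]; exact x.top_mem) hx
  map_inf' a b := Set.ext fun x => ⟨fun h => ⟨x.mem_of_le h inf_le_left, x.mem_of_le h inf_le_right⟩,
    fun h => x.inf_mem h.1 h.2⟩
  map_sup' a b := Set.ext fun x => by
    constructor
    · intro h
      by_contra hc
      replace hc := not_or.1 (show ¬(a ∈ x.carrier ∨ b ∈ x.carrier) from hc)
      have := x.inf_mem (x.compl_mem_iff.2 hc.1) (x.compl_mem_iff.2 hc.2)
      rw [← compl_sup] at this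
      exact x.compl_mem_iff.1 this h
    · rintro (h | h)
      · exact x.mem_of_le h le_sup_left
      · exact x.mem_of_le h le_sup_right

theorem mem_stone {b : B} {x : Ult B} : x ∈ stone B b ↔ b ∈ x.carrier := Iff.rfl

/-- The Stone topology. -/
instance : TopologicalSpace (Ult B) := generateFrom (Set.range (stone B))

theorem isClopen_stone (b : B) : IsClopen (stone B b) := by
  constructor
  · rw [← isOpen_compl_iff, ← map_compl']
    exact isOpen_generateFrom_of_mem ⟨_, rfl⟩
  · exact isOpen_generateFrom_of_mem ⟨_, rfl⟩

instance : CompactSpace (Ult B) := by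
  refine ⟨isCompact_iff_ultrafilter_le_nhds.2 fun F _ => ?_⟩
  refine ⟨{ carrier := {b | stone B b ∈ F}
            top_mem := ?_
            inf_mem := ?_
            mem_of_le := ?_
            compl_mem_iff := ?_ }, trivial, ?_⟩
  · change stone B ⊤ ∈ F
    rw [map_top]; exact Filter.univ_mem
  · intro a b ha hb
    change stone B (a ⊓ b) ∈ F
    rw [map_inf]; exact Filter.inter_mem ha hb
  · exact fun ha h => Filter.mem_of_superset ha (OrderHomClass.mono (stone B) h)
  · intro a
    change stone B aᶜ ∈ F ↔ _
    rw [map_compl']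
    exact Ultrafilter.compl_mem_iff_notMem
  · rw [nhds_generateFrom]
    refine le_iInf₂ fun U hU => Filter.le_principal_iff.2 ?_
    obtain ⟨hU, b, rfl⟩ := hU
    exact hU

instance : TotallySeparatedSpace (Ult B) := by
  refine totallySeparatedSpace_iff_exists_isClopen.2 fun x y h => ?_
  obtain ⟨a, ha⟩ : ∃ a, ¬(a ∈ x.carrier ↔ a ∈ y.carrier) := by
    by_contra hc; push Not at hc; exact h (Ult.ext (Set.ext hc))
  by_cases h1 : a ∈ x.carrier
  · exact ⟨_, isClopen_stone a, h1, fun h2 => ha ⟨fun _ => h2, fun _ => h1⟩⟩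
  · exact ⟨_, (isClopen_stone a).compl, h1,
      fun h2 => ha ⟨fun h => (h1 h).elim, fun h => (h2 h).elim⟩⟩

theorem exists_mem_notMem {b c : B} (h : ¬b ≤ c) : ∃ x : Ult B, b ∈ x.carrier ∧ c ∉ x.carrier := by
  obtain ⟨J, hJ, hI, hF⟩ := DistribLattice.prime_ideal_of_disjoint_filter_ideal
    (F := Order.PFilter.principal b) (I := Order.Ideal.principal c) (Set.disjoint_left.2 fun a h1 h2 =>
      h ((Order.PFilter.mem_principal.1 h1).trans (Order.Ideal.mem_principal.1 h2)))
  refine ⟨{ carrier := (J : Set B)ᶜ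
            top_mem := fun hT => hJ.1.ne_univ
              (Set.eq_univ_of_forall fun a => J.lower le_top hT)
            inf_mem := fun ha hb hab => (hJ.mem_or_mem hab).elim ha hb
            mem_of_le := fun ha hab hb => ha (J.lower hab hb)
            compl_mem_iff := fun {a} => ?_ }, ?_, ?_⟩
  · rw [Set.mem_compl_iff, Set.mem_compl_iff, not_not]
    constructor
    · intro ha
      exact (hJ.mem_or_mem (x := a) (y := aᶜ) (by simp)).resolve_right ha
    · intro ha hac
      refine hJ.1.ne_univ (Set.eq_univ_of_forall fun z => J.lower (le_top : z ≤ ⊤) ?_)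
      rw [← sup_compl_eq_top (x := a)]
      exact Order.Ideal.sup_mem ha hac
  · exact fun hb => Set.disjoint_left.1 hF (Order.PFilter.mem_principal.2 le_rfl) hb
  · exact fun hc => hc (hI (Order.Ideal.mem_principal.2 le_rfl))

theorem stone_le_iff {b c : B} : stone B b ≤ stone B c ↔ b ≤ c := by
  constructor
  · intro h
    by_contra hbc
    obtain ⟨x, hb, hc⟩ := exists_mem_notMem hbc
    exact hc (h hb)
  · exact fun h => OrderHomClass.mono (stone B) h

theorem stone_injective : Function.Injective (stone B) := fun _ _ h =>
  le_antisymm (stone_le_iff.1 h.le) (stone_le_iff.1 h.ge)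

theorem isTopologicalBasis : IsTopologicalBasis (Set.range (stone B)) := by
  refine ⟨?_, ?_, rfl⟩
  · rintro _ ⟨a, rfl⟩ _ ⟨b, rfl⟩ x hx
    exact ⟨_, ⟨a ⊓ b, rfl⟩, by rw [map_inf]; exact hx, by rw [map_inf]; exact le_rfl⟩
  · exact Set.eq_univ_of_forall fun x => ⟨_, ⟨⊤, rfl⟩, x.top_mem⟩

/-- The set of ultrafilters that contain `b`, as a clopen set. -/
def stoneClopen (B : Type u) [BooleanAlgebra B] : BoundedLatticeHom B (Clopens (Ult B)) where
  toFun b := ⟨stone B b, isClopen_stone b⟩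
  map_sup' a b := Clopens.ext (map_sup (stone B) a b)
  map_inf' a b := Clopens.ext (map_inf (stone B) a b)
  map_top' := Clopens.ext (map_top (stone B))
  map_bot' := Clopens.ext (map_bot (stone B))

theorem stoneClopen_surjective : Function.Surjective (stoneClopen B) := by
  intro a
  obtain ⟨s, hs, e⟩ := eq_finite_iUnion_of_isTopologicalBasis_of_isCompact_open
    (stone B) isTopologicalBasis (a : Set (Ult B)) a.isClopen.isClosed.isCompact a.isClopen.isOpen
  suffices h : ∃ b, stone B b = ⋃ i ∈ s, stone B i by
    obtain ⟨b, hb⟩ := h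
    exact ⟨b, Clopens.ext (hb.trans e.symm)⟩
  clear e
  induction s, hs using Set.Finite.induction_on with
  | empty => exact ⟨⊥, by simp⟩
  | insert _ _ ih =>
    obtain ⟨b, hb⟩ := ih
    exact ⟨_ ⊔ b, by rw [Set.biUnion_insert, ← hb, map_sup]; rfl⟩

theorem isClosed_iff {c : Set (Ult B)} : IsClosed c ↔ ∃ S : Set B, c = ⨅ b ∈ S, stone B b := by
  constructor
  · intro hc
    refine ⟨{b | c ⊆ stone B b}, le_antisymm (le_iInf₂ fun b hb => hb) fun x hx => ?_⟩
    by_contra hxc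
    obtain ⟨_, ⟨b, rfl⟩, hxb, hb⟩ := isTopologicalBasis.exists_subset_of_mem_open (a := x) hxc
      hc.isOpen_compl
    have h1 : c ⊆ stone B bᶜ := by
      rw [map_compl']; exact Set.subset_compl_comm.1 hb
    have h2 : x ∈ stone B bᶜ := Set.mem_iInter₂.1 hx bᶜ h1
    exact x.compl_mem_iff.1 h2 hxb
  · rintro ⟨S, rfl⟩
    exact isClosed_biInter fun b _ => (isClopen_stone b).isClosed

theorem isOpen_iff {d : Set (Ult B)} : IsOpen d ↔ ∃ S : Set B, d = ⨆ b ∈ S, stone B b := by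
  constructor
  · intro hd
    refine ⟨{b | stone B b ⊆ d}, le_antisymm (fun x hx => ?_) (iSup₂_le fun b hb => hb)⟩
    obtain ⟨_, ⟨b, rfl⟩, hxb, hb⟩ := isTopologicalBasis.exists_subset_of_mem_open hx hd
    exact Set.mem_iUnion₂.2 ⟨b, hb, hxb⟩
  · rintro ⟨S, rfl⟩
    exact isOpen_biUnion fun b _ => (isClopen_stone b).isOpen

end

/-- The continuous map `h⁻¹` between spaces of ultrafilters. -/
def map {B B' : Type u} [BooleanAlgebra B] [BooleanAlgebra B'] (h : BoundedLatticeHom B B') :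
    C(Ult B', Ult B) where
  toFun x :=
    { carrier := h ⁻¹' x.carrier
      top_mem := by rw [Set.mem_preimage, map_top]; exact x.top_mem
      inf_mem := fun ha hb => by rw [Set.mem_preimage, map_inf]; exact x.inf_mem ha hb
      mem_of_le := fun ha hab => x.mem_of_le ha (OrderHomClass.mono h hab)
      compl_mem_iff := by
        intro a
        rw [Set.mem_preimage, map_compl']; exact x.compl_mem_iff }
  continuous_toFun := by
    refine continuous_generateFrom_iff.2 ?_
    rintro _ ⟨b, rfl⟩
    exact (isClopen_stone (h b)).isOpen

end Ult

/-- A canonical extension of a Boolean algebra `B`: an embedding into a complete atomic Boolean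
algebra whose image is dense and compact. -/
structure CanonicalExtension (B : Type u) [BooleanAlgebra B] where
  /-- The complete atomic Boolean algebra. -/
  carrier : Type u
  [str : CompleteAtomicBooleanAlgebra carrier]
  /-- The embedding. -/
  emb : BoundedLatticeHom B carrier
  injective : Function.Injective emb
  dense : ∀ x : carrier, ∃ 𝒮 : Set (Set B), x = ⨆ S ∈ 𝒮, ⨅ b ∈ S, emb b
  compact : ∀ S T : Set B, (⨅ b ∈ S, emb b) ≤ (⨆ b ∈ T, emb b) →
    ∃ S' T' : Set B, S' ⊆ S ∧ S'.Finite ∧ T' ⊆ T ∧ T'.Finite ∧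
      (⨅ b ∈ S', emb b) ≤ ⨆ b ∈ T', emb b

attribute [instance] CanonicalExtension.str

namespace CanonicalExtension

variable {B : Type u} [BooleanAlgebra B] (E : CanonicalExtension B)

/-- Closed elements: meets of elements of `B`. -/
def IsClosedElt (x : E.carrier) : Prop := ∃ S : Set B, x = ⨅ b ∈ S, E.emb b

/-- Open elements: joins of elements of `B`. -/
def IsOpenElt (x : E.carrier) : Prop := ∃ S : Set B, x = ⨆ b ∈ S, E.emb b

/-- The `σ`-extension of a function `B → B`. -/
def sigmaExt (dbox : B → B) (x : E.carrier) : E.carrier :=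
  sSup {y | ∃ c d : E.carrier, E.IsClosedElt c ∧ E.IsOpenElt d ∧ c ≤ x ∧ x ≤ d ∧
    y = sInf {z | ∃ b : B, c ≤ E.emb b ∧ E.emb b ≤ d ∧ z = E.emb (dbox b)}}

end CanonicalExtension

/-- The canonical extension of `B`, as the powerset of its space of ultrafilters. -/
def canExt (B : Type u) [BooleanAlgebra B] : CanonicalExtension B where
  carrier := Set (Ult B)
  emb := Ult.stone B
  injective := Ult.stone_injective
  dense X := by
    refine ⟨Ult.carrier '' X, Set.ext fun x => ?_⟩
    simp only [Set.iSup_eq_iUnion, Set.iInf_eq_iInter, Set.mem_iUnion, Set.mem_iInter,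
      Set.exists_mem_image, exists_prop]
    constructor
    · exact fun hx => ⟨x, hx, fun b hb => hb⟩
    · rintro ⟨y, hy, h⟩
      have hle : y.carrier ⊆ x.carrier := h
      have : x = y := Ult.ext (Set.Subset.antisymm (fun b hb => by
        by_contra hby
        exact x.compl_mem_iff.1 (hle (y.compl_mem_iff.2 hby)) hb) hle)
      rwa [this]
  compact S T h := by
    obtain ⟨t, ht⟩ := isCompact_univ.elim_finite_subcover
      (fun i : ↥S ⊕ ↥T => i.elim (fun b => (Ult.stone B b.1)ᶜ) (fun b => Ult.stone B b.1))
      (by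
        rintro (b | b)
        · exact (Ult.isClopen_stone _).compl.isOpen
        · exact (Ult.isClopen_stone _).isOpen)
      (fun x _ => by
        by_cases hx : x ∈ ⨅ b ∈ S, Ult.stone B b
        · obtain ⟨b, hb, hxb⟩ := Set.mem_iUnion₂.1 (h hx)
          exact Set.mem_iUnion.2 ⟨Sum.inr ⟨b, hb⟩, hxb⟩
        · simp only [Set.iInf_eq_iInter, Set.mem_iInter, not_forall] at hx
          obtain ⟨b, hb, hxb⟩ := hx
          exact Set.mem_iUnion.2 ⟨Sum.inl ⟨b, hb⟩, hxb⟩)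
    refine ⟨{b | ∃ h : b ∈ S, Sum.inl ⟨b, h⟩ ∈ t}, {b | ∃ h : b ∈ T, Sum.inr ⟨b, h⟩ ∈ t},
      fun b hb => hb.1, ?_, fun b hb => hb.1, ?_, ?_⟩
    · refine (t.finite_toSet.image (fun i : ↥S ⊕ ↥T => i.elim Subtype.val Subtype.val)).subset ?_
      rintro b ⟨h, hb⟩
      exact ⟨_, hb, rfl⟩
    · refine (t.finite_toSet.image (fun i : ↥S ⊕ ↥T => i.elim Subtype.val Subtype.val)).subset ?_
      rintro b ⟨h, hb⟩
      exact ⟨_, hb, rfl⟩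
    · intro x hx
      obtain ⟨i, hi, hxi⟩ := Set.mem_iUnion₂.1 (ht (Set.mem_univ x))
      obtain b | b := i
      · exact (hxi (Set.mem_iInter₂.1 hx _ ⟨b.2, hi⟩)).elim
      · exact Set.mem_iUnion₂.2 ⟨b, ⟨b.2, hi⟩, hxi⟩

/-- The extension of a Boolean homomorphism to a complete homomorphism between the canonical
extensions. -/
def canExtMap {B B' : Type u} [BooleanAlgebra B] [BooleanAlgebra B'] (h : BoundedLatticeHom B B') :
    CompleteLatticeHom (canExt B).carrier (canExt B').carrier :=
  CompleteLatticeHom.setPreimage (Ult.map h)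

theorem canExtMap_emb {B B' : Type u} [BooleanAlgebra B] [BooleanAlgebra B']
    (h : BoundedLatticeHom B B') (b : B) :
    canExtMap h ((canExt B).emb b) = (canExt B').emb (h b) := rfl

theorem sigmaExt_eq {B : Type u} [BooleanAlgebra B] (dbox : B → B) (e : Set (Ult B)) :
    (canExt B).sigmaExt dbox e = ({x | e ∈ sigmaNbhds
      {a | ∃ b, Ult.stoneClopen B b = a ∧ dbox b ∈ x.carrier}} : Set (Ult B)) := by
  refine Set.ext fun x => ?_
  constructor
  · rintro ⟨_, ⟨c, d, hc, hd, hce, hed, rfl⟩, hx⟩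
    refine ⟨c, d, Ult.isClosed_iff.2 hc, Ult.isOpen_iff.2 hd, hce, hed, fun a h1 h2 => ?_⟩
    obtain ⟨b, rfl⟩ := Ult.stoneClopen_surjective a
    exact ⟨b, rfl, hx _ ⟨b, h1, h2, rfl⟩⟩
  · rintro ⟨c, d, hc, hd, hce, hed, h⟩
    refine ⟨_, ⟨c, d, Ult.isClosed_iff.1 hc, Ult.isOpen_iff.1 hd, hce, hed, rfl⟩, ?_⟩
    rintro _ ⟨b, h1, h2, rfl⟩
    obtain ⟨b', hb', hx⟩ := h (Ult.stoneClopen B b) h1 h2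
    have : b' = b := Ult.stone_injective (congrArg Clopens.carrier hb')
    rw [← this]
    exact hx

/-! ### The functors in the diagram -/

/-- The inclusion of the clopen sets in the powerset. -/
def clopenCoe (X : Type u) [TopologicalSpace X] : BoundedLatticeHom (Clopens X) (Set X) where
  toFun a := a
  map_sup' _ _ := rfl
  map_inf' _ _ := rfl
  map_top' := rfl
  map_bot' := rfl

theorem satisfies_clopens {Ax : Set OneStep} {X : Type u} [TopologicalSpace X]
    (f : Clopens X → Clopens X) (h : ∀ x, IsAxSubset Ax {a | x ∈ f a}) :
    ∀ φ ∈ Ax, Satisfies f φ := by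
  intro φ hφ θ
  refine SetLike.coe_injective ?_
  change clopenCoe X _ = clopenCoe X ⊤
  rw [Form.map_eval, map_top]
  exact (satisfies_set_iff (fun a => clopenCoe X (f a))).2 h φ hφ θ

/-- The modality `□a = {x | a ∈ γ x}` on the clopens of a `D_Ax`-coalgebra `(X, γ)`. -/
def clpBox {Ax : Set OneStep} (X : Endofunctor.Coalgebra (DAx.{u} Ax)) (a : Clopens X.V) :
    Clopens X.V :=
  ⟨{x | a ∈ (X.str x).1.carrier},
    ((DHyper.isClopen_box a).preimage continuous_subtype_val).preimage X.str.hom.hom.continuous⟩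

theorem clpBox_satisfies {Ax : Set OneStep} (X : Endofunctor.Coalgebra (DAx.{u} Ax)) :
    ∀ φ ∈ Ax, Satisfies (clpBox X) φ :=
  satisfies_clopens _ fun x => (X.str x).2

/-- The Jónsson-Tarski type duality functor: a `D_Ax`-coalgebra `(X, γ)` is sent to the Boolean
algebra of clopens of `X` with `□a = {x | a ∈ γ x}`, and `f` is sent to `f⁻¹`. -/
def clpFunctor (Ax : Set OneStep) :
    (Endofunctor.Coalgebra (DAx.{u} Ax))ᵒᵖ ⥤ Endofunctor.Algebra (NAx.{u} Ax) where
  obj X :=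
    { a := BoolAlg.of (Clopens X.unop.V)
      str := BoolAlg.ofHom (NObj.lift (clpBox X.unop) (clpBox_satisfies X.unop)) }
  map {X Y} f :=
    { f := BoolAlg.ofHom (clopenComap f.unop.f.hom.hom)
      h := BoolAlg.hom_ext (NObj.hom_ext fun a => Clopens.ext (Set.ext fun y => by
        have h := congrArg (fun k => (k y).1.carrier) f.unop.h
        exact iff_of_eq (congrArg (a ∈ ·) h))) }
  map_id _ := rfl
  map_comp _ _ := rfl

/-- The modality `□a = {x | a ∈ γ x}` on the powerset of a `B_Ax`-coalgebra `(X, γ)`. -/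
def powBox {Ax : Set OneStep} (X : Endofunctor.Coalgebra (BAx.{u} Ax)) (a : Set X.V) : Set X.V :=
  {x | a ∈ (X.str x).1}

theorem powBox_satisfies {Ax : Set OneStep} (X : Endofunctor.Coalgebra (BAx.{u} Ax)) :
    ∀ φ ∈ Ax, Satisfies (powBox X) φ :=
  (satisfies_set_iff _).2 fun x => (X.str x).2

/-- The Thomason type duality functor: a `B_Ax`-coalgebra `(X, γ)` is sent to the powerset of `X`
with `□a = {x | a ∈ γ x}`, and `f` is sent to `f⁻¹`. -/
noncomputable def powFunctor (Ax : Set OneStep) :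
    (Endofunctor.Coalgebra (BAx.{u} Ax))ᵒᵖ ⥤ Endofunctor.Algebra (LAx.{u} Ax) where
  obj X :=
    { a := CABA.of (Set X.unop.V)
      str := LObj.lift (powBox X.unop) (powBox_satisfies X.unop) }
  map {X Y} f :=
    { f := CompleteLatticeHom.setPreimage f.unop.f
      h := by
        refine LObj.lift_comp_map Ax (CompleteLatticeHom.setPreimage f.unop.f)
          (powBox_satisfies X.unop) (powBox_satisfies Y.unop) fun a => ?_
        refine Set.ext fun y => ?_
        have h := congrArg
          (fun k => (k y).1) f.unop.h
        exact iff_of_eq (congrArg (a ∈ ·) h) }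
  map_id _ := rfl
  map_comp _ _ := rfl

/-- The modality `□` on the Boolean algebra of an `N_Ax`-algebra. -/
def algBox {Ax : Set OneStep} (B : Endofunctor.Algebra (NAx.{u} Ax)) (b : B.a) : B.a :=
  B.str.hom (NObj.gen Ax b)

theorem algBox_satisfies {Ax : Set OneStep} (B : Endofunctor.Algebra (NAx.{u} Ax)) :
    ∀ φ ∈ Ax, Satisfies (algBox B) φ :=
  fun φ hφ => (NObj.gen_satisfies φ hφ).map B.str.hom

/-- For every Stone space `X`, every `Ax`-neighborhood in `D^σ X` is also an `Ax`-neighborhood in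
`B X`. -/
def SigmaPreserved (Ax : Set OneStep) : Prop :=
  ∀ (X : Profinite.{u}) (W : DSigma X), IsAxSubset Ax W.trace → IsAxSubset Ax W.carrier

theorem SigmaPreserved.sigmaNbhds {Ax : Set OneStep} (h : SigmaPreserved.{u} Ax)
    (X : Profinite.{u}) {W : Set (Clopens X)} (hW : IsAxSubset Ax W) :
    IsAxSubset Ax (sigmaNbhds W) :=
  h X (DSigma.ofTrace W) (by rwa [DSigma.trace_ofTrace])

theorem algBox_nbhds {Ax : Set OneStep} (B : Endofunctor.Algebra (NAx.{u} Ax)) (x : Ult B.a) :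
    IsAxSubset Ax {a | ∃ b, Ult.stoneClopen B.a b = a ∧ algBox B b ∈ x.carrier} := by
  refine IsAxSubset.of_preimage (Ult.stoneClopen B.a) Ult.stoneClopen_surjective ?_
  have h : (Ult.stoneClopen B.a) ⁻¹'
      {a | ∃ b, Ult.stoneClopen B.a b = a ∧ algBox B b ∈ x.carrier} =
      {b | x ∈ Ult.stone B.a (algBox B b)} := Set.ext fun b =>
    ⟨fun ⟨b', hb', hx⟩ => by
      have e : b' = b := Ult.stone_injective (congrArg Clopens.carrier hb')
      rwa [← e], fun hx => ⟨b, rfl, hx⟩⟩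
  rw [h]
  exact (satisfies_set_iff (fun b => Ult.stone B.a (algBox B b))).1
    (fun φ hφ => (algBox_satisfies B φ hφ).map (Ult.stone B.a)) x

theorem sigmaExt_satisfies {Ax : Set OneStep} (hAx : SigmaPreserved.{u} Ax)
    (B : Endofunctor.Algebra (NAx.{u} Ax)) :
    ∀ φ ∈ Ax, Satisfies ((canExt B.a).sigmaExt (algBox B)) φ := by
  refine (satisfies_set_iff (X := Ult B.a) ((canExt B.a).sigmaExt (algBox B))).2 fun x => ?_
  have h := hAx.sigmaNbhds (Profinite.of (Ult B.a)) (algBox_nbhds B x)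
  refine (congrArg (IsAxSubset Ax) (Set.ext fun e => ?_)).mpr h
  exact iff_of_eq (congrArg (fun s : Set (Ult B.a) => x ∈ s) (sigmaExt_eq (algBox B) e))

/-- The functor `σ`: an `N_Ax`-algebra `(B, □)` is sent to the canonical extension of `B` with the
`σ`-extension of `□`, and `h : B → B'` is sent to its extension to a complete homomorphism between
the canonical extensions. -/
noncomputable def sigmaFunctor (Ax : Set OneStep) (hConv : Implies.{u} Ax convAx)
    (hAx : SigmaPreserved.{u} Ax) :
    Endofunctor.Algebra (NAx.{u} Ax) ⥤ Endofunctor.Algebra (LAx.{u} Ax) where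
  obj B :=
    { a := CABA.of (canExt B.a).carrier
      str := LObj.lift ((canExt B.a).sigmaExt (algBox B)) (sigmaExt_satisfies hAx B) }
  map {B B'} h :=
    { f := canExtMap h.f.hom
      h := by
        refine LObj.lift_comp_map Ax (canExtMap h.f.hom)
          (sigmaExt_satisfies hAx B) (sigmaExt_satisfies hAx B') fun e => ?_
        refine (sigmaExt_eq (algBox B') _).trans (Eq.trans (Set.ext fun x => ?_)
          (congrArg (canExtMap h.f.hom) (sigmaExt_eq (algBox B) e)).symm)
        refine (preimage_mem_sigmaNbhds (Ult.map h.f.hom)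
          ((algBox_nbhds B' x).convex hConv) e).trans ?_
        refine iff_of_eq (congrArg (e ∈ sigmaNbhds ·) ?_)
        refine Set.ext fun a => ?_
        obtain ⟨b, rfl⟩ := Ult.stoneClopen_surjective a
        have key : algBox B' (h.f b) = h.f (algBox B b) :=
          congrArg (fun k => k.hom (NObj.gen Ax b)) h.h
        constructor
        · rintro ⟨b', hb', hx⟩
          have e : b' = h.f b := Ult.stone_injective (congrArg Clopens.carrier hb')
          rw [e, key] at hx
          exact ⟨b, rfl, hx⟩
        · rintro ⟨b', hb', hx⟩
          have e : b' = b := Ult.stone_injective (congrArg Clopens.carrier hb')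
          rw [e] at hx
          refine ⟨h.f b, rfl, ?_⟩
          rw [key]
          exact hx }
  map_id _ := rfl
  map_comp _ _ := rfl

/-- The functor `Σ_Ax`: a `D_Ax`-coalgebra `(X, γ)` is sent to the underlying set of `X` with the
`σ`-extensions of the neighborhoods `γ x`. -/
def SigmaFunctor (Ax : Set OneStep) (hConv : Implies.{u} Ax convAx) (hAx : SigmaPreserved.{u} Ax) :
    Endofunctor.Coalgebra (DAx.{u} Ax) ⥤ Endofunctor.Coalgebra (BAx.{u} Ax) where
  obj X :=
    { V := X.V
      str := TypeCat.ofHom fun x : X.V =>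
        (⟨sigmaNbhds (X.str x).1.carrier,
          hAx.sigmaNbhds X.V (X.str x).2⟩ :
          {W : Set (Set X.V) // IsAxSubset Ax W}) }
  map {X Y} f :=
    { f := TypeCat.ofHom f.f
      h := by
        refine ConcreteCategory.hom_ext _ _ fun x => Subtype.ext (Set.ext fun e => ?_)
        have h := congrArg (fun k => (k x).1.carrier) f.h
        refine (preimage_mem_sigmaNbhds f.f.hom.hom ((X.str x).2.convex hConv) e).trans ?_
        exact iff_of_eq (congrArg (e ∈ sigmaNbhds ·) h) }
  map_id _ := rfl
  map_comp _ _ := rfl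

/-- The forgetful functor `U_Ax`: a `D^σ_Ax`-coalgebra `(X, γ)` is sent to the underlying set of `X`
with the neighborhoods `γ x`. -/
def UFunctor (Ax : Set OneStep) (hConv : Implies.{u} Ax convAx) (hAx : SigmaPreserved.{u} Ax) :
    Endofunctor.Coalgebra (DSigmaAx.{u} Ax hConv) ⥤ Endofunctor.Coalgebra (BAx.{u} Ax) where
  obj X :=
    { V := X.V
      str := TypeCat.ofHom fun x : X.V =>
        (⟨(X.str x).1.carrier,
          hAx X.V _ (X.str x).2⟩ :
          {W : Set (Set X.V) // IsAxSubset Ax W}) }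
  map {X Y} f :=
    { f := TypeCat.ofHom f.f
      h := by
        refine ConcreteCategory.hom_ext _ _ fun x => Subtype.ext ?_
        exact congrArg (fun k => (k x).1.carrier) f.h }
  map_id _ := rfl
  map_comp _ _ := rfl

/-- The functor `Coalg(D_Ax) ⥤ Coalg(D^σ_Ax)` that post-composes the structure map with
`W ↦ W^σ`. -/
def toDSigma (Ax : Set OneStep) (hConv : Implies.{u} Ax convAx) :
    Endofunctor.Coalgebra (DAx.{u} Ax) ⥤ Endofunctor.Coalgebra (DSigmaAx.{u} Ax hConv) :=
  Endofunctor.Coalgebra.functorOfNatTrans (sigmaTrans Ax hConv)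

end NbhdDuality

open NbhdDuality

namespace NbhdDuality

/-! ### The points of a Stone space as ultrafilters of clopens -/

section UltHomeo

variable {X : Type u} [TopologicalSpace X]

/-- The ultrafilter of all clopen sets that contain a given point. -/
def Ult.ofPoint (x : X) : Ult (Clopens X) where
  carrier := {a | x ∈ a}
  top_mem := trivial
  inf_mem ha hb := ⟨ha, hb⟩
  mem_of_le ha hab := hab ha
  compl_mem_iff := Iff.rfl

theorem Ult.mem_ofPoint {x : X} {a : Clopens X} : a ∈ (Ult.ofPoint x).carrier ↔ x ∈ a := Iff.rfl

theorem Ult.continuous_ofPoint : Continuous (Ult.ofPoint : X → Ult (Clopens X)) := by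
  refine continuous_generateFrom_iff.2 ?_
  rintro _ ⟨a, rfl⟩
  exact a.isClopen.isOpen

theorem Ult.ofPoint_injective [TotallySeparatedSpace X] :
    Function.Injective (Ult.ofPoint : X → Ult (Clopens X)) := by
  intro x y h
  by_contra hxy
  obtain ⟨U, hU, hx, hy⟩ := totallySeparatedSpace_iff_exists_isClopen.1 inferInstance hxy
  have hx' : (⟨U, hU⟩ : Clopens X) ∈ (Ult.ofPoint x).carrier := hx
  rw [h] at hx'
  exact hy hx'

theorem Ult.ofPoint_surjective [CompactSpace X] :
    Function.Surjective (Ult.ofPoint : X → Ult (Clopens X)) := by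
  intro x
  by_contra hx
  have hcl : IsClosed (Set.range (Ult.ofPoint : X → Ult (Clopens X))) :=
    (isCompact_range Ult.continuous_ofPoint).isClosed
  obtain ⟨_, ⟨a, rfl⟩, hxa, ha⟩ :=
    Ult.isTopologicalBasis.exists_subset_of_mem_open (a := x) hx hcl.isOpen_compl
  have hbot : a = ⊥ := Clopens.ext (Set.eq_empty_of_forall_notMem fun y hy => ha hy ⟨y, rfl⟩)
  rw [Ult.mem_stone, hbot, ← compl_top] at hxa
  exact x.compl_mem_iff.1 hxa x.top_mem

/-- A Stone space is homeomorphic to the space of ultrafilters of its clopens. -/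
noncomputable def ultHomeo (X : Type u) [TopologicalSpace X] [CompactSpace X]
    [TotallySeparatedSpace X] : X ≃ₜ Ult (Clopens X) :=
  Continuous.homeoOfEquivCompactToT2
    (f := Equiv.ofBijective _ ⟨Ult.ofPoint_injective, Ult.ofPoint_surjective⟩)
    Ult.continuous_ofPoint

theorem ultHomeo_apply [CompactSpace X] [TotallySeparatedSpace X] (x : X) :
    ultHomeo X x = Ult.ofPoint x := rfl

theorem ultHomeo_symm_mem [CompactSpace X] [TotallySeparatedSpace X] (x : Ult (Clopens X))
    (a : Clopens X) : (ultHomeo X).symm x ∈ a ↔ a ∈ x.carrier := by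
  rw [← Ult.mem_ofPoint, ← ultHomeo_apply, Homeomorph.apply_symm_apply]

theorem clopenComap_injective {Y : Type u} [TopologicalSpace Y] [TotallySeparatedSpace X]
    {f g : C(Y, X)} (h : clopenComap f = clopenComap g) : f = g := by
  refine ContinuousMap.ext fun y => Ult.ofPoint_injective (Ult.ext (Set.ext fun a => ?_))
  exact iff_of_eq (congrArg (fun k : BoundedLatticeHom (Clopens X) (Clopens Y) => y ∈ k a) h)

theorem clopenComap_surjective {Y : Type u} [TopologicalSpace Y] [CompactSpace X]
    [TotallySeparatedSpace X] (h : BoundedLatticeHom (Clopens X) (Clopens Y)) :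
    ∃ f : C(Y, X), clopenComap f = h := by
  refine ⟨((ultHomeo X).symm : C(Ult (Clopens X), X)).comp
    ((Ult.map h).comp ⟨Ult.ofPoint, Ult.continuous_ofPoint⟩), ?_⟩
  ext a y
  exact ultHomeo_symm_mem _ a

end UltHomeo

/-! ### Duality between Stone spaces and Boolean algebras -/

variable {Ax : Set OneStep}

instance clpFunctor_faithful : (clpFunctor.{u} Ax).Faithful where
  map_injective {X Y f g} h := by
    refine Quiver.Hom.unop_inj (Endofunctor.Coalgebra.ext (ConcreteCategory.hom_ext _ _ fun y => ?_))
    exact congrArg (fun k : C(Y.unop.V, X.unop.V) => k y)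
      (clopenComap_injective (congrArg (fun k => k.f.hom) h))

theorem algBox_map {B B' : Endofunctor.Algebra (NAx.{u} Ax)} (h : B ⟶ B') (b : B.a) :
    algBox B' (h.f b) = h.f (algBox B b) :=
  congrArg (fun k => k.hom (NObj.gen Ax b)) h.h

instance clpFunctor_full : (clpFunctor.{u} Ax).Full where
  map_surjective {X Y} h := by
    obtain ⟨f, hf⟩ := clopenComap_surjective (X := X.unop.V) (Y := Y.unop.V) h.f.hom
    refine ⟨Quiver.Hom.op ⟨CompHausLike.ofHom _ f, ?_⟩, ?_⟩
    · refine ConcreteCategory.hom_ext _ _ fun y => Subtype.ext (DHyper.ext (Set.ext fun a => ?_))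
      have key : clpBox Y.unop (clopenComap f a) = clopenComap f (clpBox X.unop a) := by
        rw [hf]; exact algBox_map h a
      exact iff_of_eq (congrArg (fun b : Clopens Y.unop.V => y ∈ b) key)
    · refine Endofunctor.Algebra.ext (BoolAlg.hom_ext ?_)
      exact hf

/-- The isomorphism between a Boolean algebra and the clopens of its space of ultrafilters. -/
noncomputable def stoneOrderIso (B : Type u) [BooleanAlgebra B] : B ≃o Clopens (Ult B) :=
  RelIso.ofSurjective (OrderEmbedding.ofMapLEIff (Ult.stoneClopen B) fun _ _ => Ult.stone_le_iff)
    Ult.stoneClopen_surjective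

/-- The space of ultrafilters of an `N_Ax`-algebra, as a `D_Ax`-coalgebra. -/
def ultCoalgebra (B : Endofunctor.Algebra (NAx.{u} Ax)) : Endofunctor.Coalgebra (DAx.{u} Ax) where
  V := Profinite.of (Ult B.a)
  str := CompHausLike.ofHom _
    { toFun := fun x => (⟨⟨_⟩, algBox_nbhds B x⟩ : DAxSpace Ax (Ult B.a))
      continuous_toFun := by
        refine continuous_induced_rng.2 (DHyper.continuous_iff.2 fun a => ?_)
        obtain ⟨b, rfl⟩ := Ult.stoneClopen_surjective a
        refine (congrArg IsClopen (Set.ext fun x => ?_)).mpr (Ult.isClopen_stone (algBox B b))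
        constructor
        · rintro ⟨b', hb', hx⟩
          rwa [Ult.stone_injective (congrArg Clopens.carrier hb')] at hx
        · exact fun hx => ⟨b, rfl, hx⟩ }

theorem clpBox_ultCoalgebra (B : Endofunctor.Algebra (NAx.{u} Ax)) (b : B.a) :
    clpBox (ultCoalgebra B) (Ult.stoneClopen B.a b) = Ult.stoneClopen B.a (algBox B b) := by
  refine Clopens.ext (Set.ext fun x => ?_)
  constructor
  · rintro ⟨b', hb', hx⟩
    rwa [Ult.stone_injective (congrArg Clopens.carrier hb')] at hx
  · exact fun hx => ⟨b, rfl, hx⟩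

/-- Every `N_Ax`-algebra is isomorphic to the clopen algebra of its space of ultrafilters. -/
noncomputable def stoneAlgebraIso (B : Endofunctor.Algebra (NAx.{u} Ax)) :
    B ≅ (clpFunctor Ax).obj (op (ultCoalgebra B)) :=
  Endofunctor.Algebra.isoMk (BoolAlg.Iso.mk (stoneOrderIso B.a))
    (BoolAlg.hom_ext (NObj.hom_ext fun b => clpBox_ultCoalgebra B b))

instance clpFunctor_essSurj : (clpFunctor.{u} Ax).EssSurj where
  mem_essImage B := ⟨op (ultCoalgebra B), ⟨(stoneAlgebraIso B).symm⟩⟩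

instance clpFunctor_isEquivalence : (clpFunctor.{u} Ax).IsEquivalence where

/-! ### Duality between sets and complete atomic Boolean algebras -/

theorem setPreimage_injective {X Y : Type u} {f g : Y → X}
    (h : CompleteLatticeHom.setPreimage f = CompleteLatticeHom.setPreimage g) : f = g := by
  funext y
  have : y ∈ CompleteLatticeHom.setPreimage g {f y} := by rw [← h]; exact rfl
  exact Eq.symm this

theorem setPreimage_surjective {X Y : Type u} (h : CompleteLatticeHom (Set X) (Set Y)) :
    ∃ f : Y → X, CompleteLatticeHom.setPreimage f = h := by
  have hsup : ∀ a : Set X, h a = ⋃ x ∈ a, h {x} := fun a => by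
    conv_lhs => rw [← Set.biUnion_of_singleton a]
    exact map_iSup₂ h fun x _ => {x}
  have hex : ∀ y, ∃ x, y ∈ h {x} := fun y => by
    have hy : y ∈ h Set.univ := by rw [← Set.top_eq_univ, map_top]; trivial
    rw [hsup] at hy
    obtain ⟨x, -, hx⟩ := Set.mem_iUnion₂.1 hy
    exact ⟨x, hx⟩
  choose f hf using hex
  refine ⟨f, ?_⟩
  ext a y
  rw [CompleteLatticeHom.setPreimage_apply, Set.mem_preimage, hsup, Set.mem_iUnion₂]
  constructor
  · exact fun hy => ⟨f y, hy, hf y⟩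
  · rintro ⟨x, hx, hyx⟩
    by_contra hfy
    have hne : ({f y} : Set X) ⊓ {x} = ⊥ :=
      Set.singleton_inter_eq_empty.2 fun e => hfy (e.symm ▸ hx)
    have hy : y ∈ h ({f y} ⊓ {x}) := by rw [map_inf]; exact ⟨hf y, hyx⟩
    rw [hne, map_bot] at hy
    exact hy

/-- The modality on the complete atomic Boolean algebra of an `L_Ax`-algebra. -/
noncomputable def cabaBox (A : Endofunctor.Algebra (LAx.{u} Ax)) (a : A.a) : A.a :=
  (show CompleteLatticeHom (LObj Ax A.a) A.a from A.str) (LObj.gen Ax a)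

theorem cabaBox_satisfies (A : Endofunctor.Algebra (LAx.{u} Ax)) :
    ∀ φ ∈ Ax, Satisfies (cabaBox A) φ := fun φ hφ =>
  (LObj.gen_satisfies φ hφ).map
    (show CompleteLatticeHom (LObj Ax A.a) A.a from A.str).toBoundedLatticeHom

theorem cabaBox_of_str {A : Type u} [CompleteAtomicBooleanAlgebra A] {f : A → A}
    (hf : ∀ φ ∈ Ax, Satisfies f φ) (a : A) :
    cabaBox (⟨CABA.of A, LObj.lift f hf⟩ : Endofunctor.Algebra (LAx.{u} Ax)) a = f a :=
  LObj.lift_gen f hf a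

/-- A complete homomorphism between the carriers of `L_Ax`-algebras is a homomorphism of algebras if
and only if it preserves the modality. -/
theorem LAx_hom_iff {A A' : Endofunctor.Algebra (LAx.{u} Ax)} (h : CompleteLatticeHom A.a A'.a) :
    (LAx Ax).map (X := A.a) (Y := A'.a) h ≫ A'.str = A.str ≫ (show A.a ⟶ A'.a from h) ↔
      ∀ a, cabaBox A' (h a) = h (cabaBox A a) := by
  have key : ∀ a, (show CompleteLatticeHom (LObj Ax A.a) A'.a from
      (LAx Ax).map (X := A.a) (Y := A'.a) h ≫ A'.str) (LObj.gen Ax a) = cabaBox A' (h a) :=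
    fun a => congrArg (show CompleteLatticeHom (LObj Ax A'.a) A'.a from A'.str)
      (LObj.map_gen Ax h a)
  constructor
  · intro H a
    rw [← key, H]
    rfl
  · exact fun H => LObj.hom_ext fun a => (key a).trans (H a)

theorem cabaBox_powFunctor (X : Endofunctor.Coalgebra (BAx.{u} Ax)) (a : Set X.V) :
    cabaBox ((powFunctor Ax).obj (op X)) a = powBox X a :=
  LObj.lift_gen (powBox X) (powBox_satisfies X) a

instance powFunctor_faithful : (powFunctor.{u} Ax).Faithful where
  map_injective {X Y f g} h := by
    refine Quiver.Hom.unop_inj (Endofunctor.Coalgebra.ext (ConcreteCategory.hom_ext _ _ fun y => ?_))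
    exact congrFun (setPreimage_injective (congrArg (fun k => k.f) h)) y

instance powFunctor_full : (powFunctor.{u} Ax).Full where
  map_surjective {X Y} h := by
    obtain ⟨f, hf⟩ := setPreimage_surjective (X := X.unop.V) (Y := Y.unop.V) h.f
    refine ⟨Quiver.Hom.op ⟨TypeCat.ofHom f, ?_⟩, ?_⟩
    · refine ConcreteCategory.hom_ext _ _ fun y => Subtype.ext (Set.ext fun a => ?_)
      have key := (LAx_hom_iff _).1 h.h a
      rw [← hf] at key
      replace key := ((cabaBox_powFunctor Y.unop (f ⁻¹' a)).symm.trans key).trans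
        (congrArg (CompleteLatticeHom.setPreimage f) (cabaBox_powFunctor X.unop a))
      exact iff_of_eq (congrArg (fun b : Set Y.unop.V => y ∈ b) key)
    · exact Endofunctor.Algebra.ext hf

/-- An order isomorphism between complete atomic Boolean algebras as an isomorphism of `CABA`. -/
def CABA.isoMk {A A' : Type u} [CompleteAtomicBooleanAlgebra A] [CompleteAtomicBooleanAlgebra A']
    (e : A ≃o A') : CABA.of A ≅ CABA.of A' where
  hom := (e : CompleteLatticeHom A A')
  inv := (e.symm : CompleteLatticeHom A' A)
  hom_inv_id := CompleteLatticeHom.ext e.symm_apply_apply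
  inv_hom_id := CompleteLatticeHom.ext e.apply_symm_apply

/-- An order isomorphism that preserves the modalities is an isomorphism of `L_Ax`-algebras. -/
noncomputable def LAx.isoMk {A A' : Endofunctor.Algebra (LAx.{u} Ax)} (e : A.a ≃o A'.a)
    (he : ∀ a, cabaBox A' (e a) = e (cabaBox A a)) : A ≅ A' :=
  Endofunctor.Algebra.isoMk (CABA.isoMk e) ((LAx_hom_iff (e : CompleteLatticeHom A.a A'.a)).2 he)

/-- The `B_Ax`-coalgebra on the set `X` that corresponds to an `L_Ax`-algebra whose carrier is
isomorphic to the powerset of `X`. -/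
noncomputable def setCoalgebra (A : Endofunctor.Algebra (LAx.{u} Ax)) {X : Type u}
    (e : A.a ≃o Set X) : Endofunctor.Coalgebra (BAx.{u} Ax) where
  V := X
  str := TypeCat.ofHom fun x =>
    (⟨{b | x ∈ e (cabaBox A (e.symm b))},
      (satisfies_set_iff fun b => e (cabaBox A (e.symm b))).1 (fun φ hφ =>
        ((cabaBox_satisfies A φ hφ).map (e : BoundedLatticeHom A.a (Set X))).comp
          (e.symm : BoundedLatticeHom (Set X) A.a)) x⟩ :
      {W : Set (Set X) // IsAxSubset Ax W})

theorem powBox_setCoalgebra (A : Endofunctor.Algebra (LAx.{u} Ax)) {X : Type u}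
    (e : A.a ≃o Set X) (a : A.a) : powBox (setCoalgebra A e) (e a) = e (cabaBox A a) := by
  change e (cabaBox A (e.symm (e a))) = _
  rw [OrderIso.symm_apply_apply]

/-- An `L_Ax`-algebra whose carrier is isomorphic to a powerset is isomorphic to the complex algebra
of the corresponding `B_Ax`-coalgebra. -/
noncomputable def setAlgebraIso (A : Endofunctor.Algebra (LAx.{u} Ax)) {X : Type u}
    (e : A.a ≃o Set X) : A ≅ (powFunctor Ax).obj (op (setCoalgebra A e)) :=
  LAx.isoMk (A' := (powFunctor Ax).obj (op (setCoalgebra A e))) e fun a =>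
    (cabaBox_powFunctor (setCoalgebra A e) (e a)).trans (powBox_setCoalgebra A e a)

instance powFunctor_essSurj : (powFunctor.{u} Ax).EssSurj where
  mem_essImage A := 
    ⟨op (setCoalgebra A CompleteAtomicBooleanAlgebra.toSetOfIsAtom), ⟨(setAlgebraIso A _).symm⟩⟩

instance powFunctor_isEquivalence : (powFunctor.{u} Ax).IsEquivalence where

/-! ### The canonical extension of the dual algebra -/

/-- The inverse image along a bijection, as an isomorphism between powersets. -/
def preimageOrderIso {X Y : Type u} (e : X ≃ Y) : Set Y ≃o Set X where
  toFun a := e ⁻¹' a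
  invFun a := e.symm ⁻¹' a
  left_inv a := e.symm_preimage_preimage a
  right_inv a := e.preimage_symm_preimage a
  map_rel_iff' := e.surjective.preimage_subset_preimage_iff

theorem preimage_ultHomeo_sigmaExt (hConv : Implies.{u} Ax convAx)
    (X : Endofunctor.Coalgebra (DAx.{u} Ax)) (e : Set (Ult (Clopens X.V))) :
    preimageOrderIso (ultHomeo X.V).toEquiv ((canExt (Clopens X.V)).sigmaExt (clpBox X) e) =
      {x | ultHomeo X.V ⁻¹' e ∈ sigmaNbhds (X.str x).1.carrier} := by
  refine Set.ext fun x => ?_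
  have h := congrArg (fun s : Set (Ult (Clopens X.V)) => ultHomeo X.V x ∈ s)
    (sigmaExt_eq (clpBox X) e)
  refine (iff_of_eq h).trans ((iff_of_eq ?_).trans
    (preimage_mem_sigmaNbhds (ultHomeo X.V : C(X.V, Ult (Clopens X.V)))
      ((X.str x).2.convex hConv) e).symm)
  refine congrArg (e ∈ sigmaNbhds ·) (Set.ext fun a => ?_)
  obtain ⟨b, rfl⟩ := Ult.stoneClopen_surjective a
  constructor
  · rintro ⟨b', hb', hx⟩
    rw [Ult.stone_injective (congrArg Clopens.carrier hb')] at hx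
    exact hx
  · exact fun hx => ⟨b, rfl, hx⟩

/-- The component at `X` of the isomorphism between the canonical extension of the dual algebra of a
`D_Ax`-coalgebra and the powerset of its `σ`-extension: the inverse image along the homeomorphism
from `X` to the ultrafilters of clopens of `X`. -/
noncomputable def sigmaClpIso (hConv : Implies.{u} Ax convAx) (hAx : SigmaPreserved.{u} Ax)
    (X : Endofunctor.Coalgebra (DAx.{u} Ax)) :
    (sigmaFunctor Ax hConv hAx).obj ((clpFunctor Ax).obj (op X)) ≅
      (powFunctor Ax).obj (op ((SigmaFunctor Ax hConv hAx).obj X)) :=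
  LAx.isoMk (A := (sigmaFunctor Ax hConv hAx).obj ((clpFunctor Ax).obj (op X)))
    (A' := (powFunctor Ax).obj (op ((SigmaFunctor Ax hConv hAx).obj X)))
    (preimageOrderIso (ultHomeo X.V).toEquiv) fun e =>
      (cabaBox_powFunctor ((SigmaFunctor Ax hConv hAx).obj X) _).trans
        ((preimage_ultHomeo_sigmaExt hConv X e).symm.trans
          (congrArg (preimageOrderIso (ultHomeo X.V).toEquiv)
            (cabaBox_of_str (sigmaExt_satisfies hAx ((clpFunctor Ax).obj (op X))) e).symm))

/-- The canonical extension of the dual algebra is naturally isomorphic to the powerset of the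
`σ`-extension. -/
noncomputable def sigmaClpNatIso (hConv : Implies.{u} Ax convAx) (hAx : SigmaPreserved.{u} Ax) :
    clpFunctor Ax ⋙ sigmaFunctor Ax hConv hAx ≅ (SigmaFunctor Ax hConv hAx).op ⋙ powFunctor Ax :=
  NatIso.ofComponents (fun X => sigmaClpIso hConv hAx X.unop) fun _ => rfl

/-! ### The isomorphism between the categories of coalgebras -/

/-- The natural transformation from `D^σ_Ax` to `D_Ax` that restricts a neighborhood to the
clopens. -/
def traceTrans (Ax : Set OneStep) (hConv : Implies.{u} Ax convAx) :
    DSigmaAx Ax hConv ⟶ DAx Ax where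
  app X := CompHausLike.ofHom _ ⟨(sigmaHomeo Ax X).symm, (sigmaHomeo Ax X).symm.continuous⟩
  naturality _ _ _ := rfl

theorem sigmaTrans_comp_traceTrans (hConv : Implies.{u} Ax convAx) :
    sigmaTrans Ax hConv ≫ traceTrans Ax hConv = 𝟙 _ :=
  NatTrans.ext (funext fun X =>
    ConcreteCategory.hom_ext _ _ fun W => (sigmaHomeo Ax X).symm_apply_apply W)

theorem traceTrans_comp_sigmaTrans (hConv : Implies.{u} Ax convAx) :
    traceTrans Ax hConv ≫ sigmaTrans Ax hConv = 𝟙 _ :=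
  NatTrans.ext (funext fun X =>
    ConcreteCategory.hom_ext _ _ fun W => (sigmaHomeo Ax X).apply_symm_apply W)

theorem coalgebra_hom_heq {C : Type*} [Category* C] {F : C ⥤ C} {V V' : C} {s t : V ⟶ F.obj V}
    {s' t' : V' ⟶ F.obj V'} (hs : s = t) (hs' : s' = t')
    (f : (⟨V, s⟩ : Endofunctor.Coalgebra F) ⟶ ⟨V', s'⟩)
    (g : (⟨V, t⟩ : Endofunctor.Coalgebra F) ⟶ ⟨V', t'⟩) (h : f.f = g.f) : f ≍ g := by
  subst hs hs'
  exact heq_of_eq (Endofunctor.Coalgebra.ext h)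

/-- Post-composition with mutually inverse natural transformations yields, strictly, the identity
functor on coalgebras. -/
theorem functorOfNatTrans_comp_eq_id {C : Type*} [Category* C] {F G : C ⥤ C} {α : F ⟶ G}
    {β : G ⟶ F} (h : α ≫ β = 𝟙 F) :
    Endofunctor.Coalgebra.functorOfNatTrans α ⋙ Endofunctor.Coalgebra.functorOfNatTrans β =
      𝟭 (Endofunctor.Coalgebra F) := by
  have key : ∀ X : Endofunctor.Coalgebra F, (X.str ≫ α.app X.V) ≫ β.app X.V = X.str := fun X => by
    rw [Category.assoc, ← NatTrans.comp_app, h, NatTrans.id_app, Category.comp_id]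
  refine CategoryTheory.Functor.hext (fun X => ?_) fun X Y f => ?_
  · exact congrArg (Endofunctor.Coalgebra.mk X.V) (key X)
  · exact coalgebra_hom_heq (key X) (key Y) _ f rfl

end NbhdDuality

theorem mainTheorem12 (Ax : Set OneStep) (hConv : Implies.{u} Ax convAx)
    (hAx : ∀ (X : Profinite.{u}) (W : DSigma X),
      IsAxSubset Ax W.trace → IsAxSubset Ax W.carrier) :
    (clpFunctor.{u} Ax).IsEquivalence ∧
    (powFunctor.{u} Ax).IsEquivalence ∧
    Nonempty (clpFunctor Ax ⋙ sigmaFunctor Ax hConv hAx ≅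
      (SigmaFunctor Ax hConv hAx).op ⋙ powFunctor Ax) ∧
    (∃ Ψ : Endofunctor.Coalgebra (DSigmaAx Ax hConv) ⥤ Endofunctor.Coalgebra (DAx Ax),
      toDSigma Ax hConv ⋙ Ψ = 𝟭 _ ∧ Ψ ⋙ toDSigma Ax hConv = 𝟭 _) ∧
    toDSigma Ax hConv ⋙ UFunctor Ax hConv hAx = SigmaFunctor Ax hConv hAx :=
  ⟨clpFunctor_isEquivalence, powFunctor_isEquivalence, ⟨sigmaClpNatIso hConv hAx⟩,
    ⟨Endofunctor.Coalgebra.functorOfNatTrans (traceTrans Ax hConv),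
      functorOfNatTrans_comp_eq_id (sigmaTrans_comp_traceTrans hConv),
      functorOfNatTrans_comp_eq_id (traceTrans_comp_sigmaTrans hConv)⟩, rfl⟩
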